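/- An Orlicz function is a convex, symmetric function $V:\mathbb R\to[0,\infty)$ with $V(0)=0$ and $V(x)>0$ for $x\ne0$. Let $\mathscr M_1(\mathbb R)$ be the set of Borel probability measures on $\mathbb R$ with the weak topology. For an Orlicz function $V$ and $\mu\in\mathscr M_1(\mathbb R)$ put $m_V(\mu)=\int V\,d\mu\in[0,\infty]$ and $\mathscr M_1^V(\mathbb R)=\{\mu\in\mathscr M_1(\mathbb R): m_V(\mu)<\infty\}$, with the metric $d_V(\mu,\nu)=d_w(\mu,\nu)+|m_V(\mu)-m_V(\nu)|$, where $d_w$ is any metric on $\mathscr M_1(\mathbb R)$ inducing the weak topology. For $\beta<0$ let $\mu_{V,\beta}$ be the probability measure with Lebesgue density $e^{\beta V(x)}/\int_{\mathbb R}e^{\beta V(t)}\,dt$, and let $H(\mu|\nu)=\int\log\frac{d\mu}{d\nu}\,d\mu$ if $\mu\ll\nu$, and $H(\mu|\nu)=\infty$ otherwise, be the relative entropy. A sequence $(\xi_n)_{n\ge1}$ of random variables in a topological space $\mathcal X$ satisfies an LDP in $\mathcal X$ with good rate function $I:\mathcal X\to[0,\infty]$ if all level sets $\{I\le c\}$,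 $c\in[0,\infty)$, are compact and, for every Borel set $A\subseteq\mathcal X$ with interior $A^\circ$ and closure $\overline A$, $$-\inf_{A^\circ} I\le\liminf_{n\to\infty}\tfrac1n\log\mathbb P[\xi_n\in A^\circ]\le\limsup_{n\to\infty}\tfrac1n\log\mathbb P[\xi_n\in\overline A]\le-\inf_{\overline A} I .$$ Theorem. Let $V$ be an Orlicz function, $R\in(0,\infty)$, and for every $n\ge1$ let $X^n=(X^n(1),\dots,X^n(n))$ be uniformly distributed on the Orlicz ball $\mathbb B^{n,V}_R=\{x\in\mathbb R^n:\sum_{k=1}^nV(x_k)\le Rn\}$. Put $\mathcal L^{n}=\frac1n\sum_{i=1}^n\delta_{X^n(i)}$. Then there is a unique $\overline\alpha\in(-\infty,0)$ such that $(\mathcal L^{n})_{n\ge1}$ satisfies an LDP in $\mathscr M_1(\mathbb R)$ with good rate function $\mathbb I_V:\mathscr M_1(\mathbb R)\to[0,\infty]$, $$\mathbb I_V(\mu)=\begin{cases}H(\mu|\mu_{V,\overline\alpha})+\overline\alpha\,[m_V(\mu)-R], & m_V(\mu)\le R,\\ \infty, & \text{otherwise},\end{cases}$$ and $\mathbb I_V$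 is strictly convex on the set where it is finite. If moreover $W$ is an Orlicz function with $V(x)/W(x)\to\infty$ as $|x|\to\infty$, then $(\mathcal L^{n})_{n\ge1}$ also satisfies an LDP in $(\mathscr M_1^W(\mathbb R),d_W)$, with good rate function the restriction of $\mathbb I_V$ to $\mathscr M_1^W(\mathbb R)$. -/

import Mathlib

open MeasureTheory ProbabilityTheory Filter Topology
open scoped ENNReal NNReal

noncomputable section

namespace OrliczLDP

/-- An Orlicz function: convex, symmetric, zero at the origin and positive elsewhere. -/
structure IsOrlicz (V : ℝ → ℝ) : Prop where
  convex : ConvexOn ℝ Set.univ V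
  even : ∀ x, V (-x) = V x
  zero : V 0 = 0
  pos : ∀ x, x ≠ 0 → 0 < V x

/-- The Orlicz ball of radius `R` in `ℝⁿ`: all `x` with `V (x₁) + ⋯ + V (xₙ) ≤ R n`. -/
def orliczBall (V : ℝ → ℝ) (R : ℝ) (n : ℕ) : Set (Fin n → ℝ) :=
  {x | ∑ k, V (x k) ≤ R * n}

/-- The Gibbs measure with Lebesgue density `exp (β V x) / ∫ exp (β V t) dt`. -/
def gibbs (V : ℝ → ℝ) (β : ℝ) : Measure ℝ :=
  (volume : Measure ℝ).withDensity
    fun x => ENNReal.ofReal (Real.exp (β * V x) / ∫ t, Real.exp (β * V t))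

/-- The moment `∫ V dμ`, with values in `[0, ∞]` (for `V ≥ 0`). -/
def moment (V : ℝ → ℝ) (μ : ProbabilityMeasure ℝ) : ℝ≥0∞ :=
  ∫⁻ x, ENNReal.ofReal (V x) ∂(μ : Measure ℝ)

/-- The set of probability measures on `ℝ` with finite `W`-moment. -/
def FiniteMoment (W : ℝ → ℝ) : Type :=
  {μ : ProbabilityMeasure ℝ // moment W μ < ∞}

/-- The weak topology on the probability measures on `ℝ`. -/
@[reducible]
def weakTopology : TopologicalSpace (ProbabilityMeasure ℝ) :=
  ProbabilityMeasure.instTopologicalSpace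

/-- The metric `d_w` induces the weak topology. -/
def InducesWeakTopology (dw : MetricSpace (ProbabilityMeasure ℝ)) : Prop :=
  dw.toPseudoMetricSpace.toUniformSpace.toTopologicalSpace = weakTopology

/-- The metric `d_W (μ, ν) = d_w (μ, ν) + |m_W (μ) - m_W (ν)|` on the probability measures with
finite `W`-moment, built from a metric `d_w` on the probability measures on `ℝ`. -/
@[reducible]
def wassersteinMetric (dw : MetricSpace (ProbabilityMeasure ℝ)) (W : ℝ → ℝ) :
    MetricSpace (FiniteMoment W) where
  dist μ ν := dw.dist μ.1 ν.1 + |(moment W μ.1).toReal - (moment W ν.1).toReal|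
  dist_self μ := by
    have h : dw.dist μ.1 μ.1 = 0 := dw.dist_self μ.1
    rw [h, sub_self, abs_zero, add_zero]
  dist_comm μ ν := by
    have h : dw.dist μ.1 ν.1 = dw.dist ν.1 μ.1 := dw.dist_comm μ.1 ν.1
    rw [h, abs_sub_comm]
  dist_triangle μ ν ρ := by
    have h : dw.dist μ.1 ρ.1 ≤ dw.dist μ.1 ν.1 + dw.dist ν.1 ρ.1 :=
      dw.dist_triangle μ.1 ν.1 ρ.1
    have h' := abs_sub_le (moment W μ.1).toReal (moment W ν.1).toReal (moment W ρ.1).toReal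
    linarith
  eq_of_dist_eq_zero := by
    intro μ ν h
    have h0 : 0 ≤ dw.dist μ.1 ν.1 := @dist_nonneg _ dw.toPseudoMetricSpace μ.1 ν.1
    have h1 := abs_nonneg ((moment W μ.1).toReal - (moment W ν.1).toReal)
    have h2 : dw.dist μ.1 ν.1 = 0 := by linarith
    exact Subtype.ext (dw.eq_of_dist_eq_zero h2)

/-- The empirical measure `(1/n) ∑ δ_{xᵢ}` of the coordinates of `x ∈ ℝⁿ`, `n ≥ 1`. -/
def empirical (n : ℕ+) (x : Fin n → ℝ) : ProbabilityMeasure ℝ :=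
  ⟨((n : ℕ) : ℝ≥0∞)⁻¹ • ∑ i, Measure.dirac (x i), ⟨by
    simp [ENNReal.inv_mul_cancel]⟩⟩

theorem moment_empirical_lt_top (W : ℝ → ℝ) (n : ℕ+) (x : Fin n → ℝ) :
    moment W (empirical n x) < ∞ := by
  simp only [moment, empirical, ProbabilityMeasure.coe_mk, lintegral_smul_measure,
    lintegral_finsetSum_measure, lintegral_dirac, smul_eq_mul]
  exact ENNReal.mul_lt_top (by simp) (ENNReal.sum_lt_top.2 fun i _ => ENNReal.ofReal_lt_top)

/-- The empirical measure as a point of the space of measures with finite `W`-moment. -/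
def empiricalFM (W : ℝ → ℝ) (n : ℕ+) (x : Fin n → ℝ) : FiniteMoment W :=
  ⟨empirical n x, moment_empirical_lt_top W n x⟩

/-- A good rate function: all level sets are compact. -/
def IsGoodRate {X : Type*} [TopologicalSpace X] (I : X → ℝ≥0∞) : Prop :=
  ∀ c : ℝ≥0, IsCompact {x | I x ≤ c}

/-- `(1/n) log p`, with values in `[-∞, 0]` for a probability `p`. -/
def logScale (n : ℕ+) (p : ℝ≥0∞) : EReal :=
  ((1 / (n : ℕ) : ℝ) : EReal) * ENNReal.log p

/-- `I` is a good rate function and `(ξ n)` satisfies the large deviation principle with speed `n`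
and rate function `I`. The variables may live on different probability spaces. -/
structure SatisfiesLDP {X : Type*} [TopologicalSpace X]
    {Ω : ℕ+ → Type*} [∀ n, MeasurableSpace (Ω n)] (P : ∀ n, Measure (Ω n))
    (ξ : ∀ n, Ω n → X) (I : X → ℝ≥0∞) : Prop where
  good : IsGoodRate I
  lower : ∀ A : Set X, MeasurableSet[borel X] A →
    -(⨅ x ∈ interior A, (I x : EReal)) ≤
      liminf (fun n => logScale n (P n {ω | ξ n ω ∈ interior A})) atTop
  middle : ∀ A : Set X, MeasurableSet[borel X] A →
    liminf (fun n => logScale n (P n {ω | ξ n ω ∈ interior A})) atTop ≤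
      limsup (fun n => logScale n (P n {ω | ξ n ω ∈ closure A})) atTop
  upper : ∀ A : Set X, MeasurableSet[borel X] A →
    limsup (fun n => logScale n (P n {ω | ξ n ω ∈ closure A})) atTop ≤
      -(⨅ x ∈ closure A, (I x : EReal))

/-- The function equal to `H(μ | μ_{V,α}) + α (m_V(μ) - R)` if `m_V(μ) ≤ R` and to `∞` otherwise.
For `α < 0` the second summand is nonnegative on the first branch, so nothing is truncated. -/
def rate (V : ℝ → ℝ) (R α : ℝ) (μ : ProbabilityMeasure ℝ) : ℝ≥0∞ :=
  open Classical in
  if moment V μ ≤ ENNReal.ofReal R then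
    InformationTheory.klDiv (μ : Measure ℝ) (gibbs V α)
      + ENNReal.ofReal (α * ((moment V μ).toReal - R))
  else ∞

/-- The mixture `a μ + b ν` of two probability measures, `a + b = 1`. -/
def mix (a b : ℝ≥0) (hab : a + b = 1) (μ ν : ProbabilityMeasure ℝ) : ProbabilityMeasure ℝ :=
  ⟨a • (μ : Measure ℝ) + b • (ν : Measure ℝ), ⟨by
    simp only [Measure.coe_add, Pi.add_apply, Measure.smul_apply, measure_univ,
      ENNReal.smul_def, smul_eq_mul, mul_one]
    exact_mod_cast hab⟩⟩

/-- Strict convexity, on the set where it is finite, of a `[0, ∞]`-valued function of a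
probability measure (the convexity inequality being trivial outside that set). -/
def StrictlyConvex (I : ProbabilityMeasure ℝ → ℝ≥0∞) : Prop :=
  ∀ μ ν : ProbabilityMeasure ℝ, μ ≠ ν → I μ < ∞ → I ν < ∞ →
    ∀ (a b : ℝ≥0) (hab : a + b = 1), 0 < a → 0 < b →
      I (mix a b hab μ ν) < a * I μ + b * I ν

end OrliczLDP

end

open OrliczLDP

/-!
On the Orlicz ball, Lebesgue measure is controlled by product measures. If `U` is a small
neighbourhood of `μ`, the volume of the points of the ball with empirical measure in `U` is at most
`exp (-n c)` for every `c < ∫ log (dμ/dx) dμ`, by the exponential Chebyshev inequality with a test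
function `γ V + g`: here `g` is bounded, continuous and nearly optimal in the Donsker–Varadhan
formula for `H(μ | μ_{V,γ})`, and `γ` is close to `0` from below. For large `n` it is at least
`exp (-n c)` for every `c > ∫ log (dμ/dx) dμ`, by a change of measure from `μⁿ` and the law of large
numbers; when `m_V(μ) = R` one first mixes `μ` with a measure of smaller moment. The number `α` is
where `log ∫ exp (β V) dx - β R` attains its minimum over `β < 0`, which makes `μ_{V,α}` have moment
`R` and the minimum be the exponential growth rate of the volume of the ball. Since the measures
with `m_V ≤ R` form a weakly compact set, these local bounds give the large deviation principle. On
that set, `W` of smaller order than `V` is uniformly integrable, so `d_W` induces the weak topology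
there and the principle carries over.
-/

namespace OrliczLDP

open InformationTheory Set
open scoped BoundedContinuousFunction

section RelativeEntropy

variable {X : Type*} [MeasurableSpace X] {μ ν : Measure X}

theorem sub_eq_sub_of_tilted_eq [TopologicalSpace X] [BorelSpace X] [SigmaFinite ν]
    [ν.IsOpenPosMeasure] {f g : X → ℝ} (hf : Continuous f) (hg : Continuous g)
    (hfν : Integrable (fun x => Real.exp (f x)) ν) (hgν : Integrable (fun x => Real.exp (g x)) ν)
    (h : ν.tilted f = ν.tilted g) (x y : X) : f x - f y = g x - g y := by
  have : NeZero ν := ⟨fun h0 => isOpen_univ.measure_ne_zero ν ⟨x, trivial⟩ (by simp [h0])⟩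
  have hdens : (fun z => Real.exp (f z) / ∫ t, Real.exp (f t) ∂ν)
      =ᵐ[ν] fun z => Real.exp (g z) / ∫ t, Real.exp (g t) ∂ν := by
    have h' := (withDensity_eq_iff_of_sigmaFinite (by fun_prop) (by fun_prop)).1 h
    filter_upwards [h'] with z hz
    exact (ENNReal.ofReal_eq_ofReal_iff (by positivity) (by positivity)).1 hz
  have heq := (Continuous.ae_eq_iff_eq ν (by fun_prop) (by fun_prop)).1 hdens
  have hlog (z : X) : f z - Real.log (∫ t, Real.exp (f t) ∂ν)
      = g z - Real.log (∫ t, Real.exp (g t) ∂ν) := by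
    have hz := congrArg Real.log (congrFun heq z)
    rwa [Real.log_div (Real.exp_ne_zero _) (integral_exp_pos hfν).ne', Real.log_exp,
      Real.log_div (Real.exp_ne_zero _) (integral_exp_pos hgν).ne', Real.log_exp] at hz
  linarith [hlog x, hlog y]

open Classical in
/-- The relative entropy of `μ` with respect to a possibly infinite measure `ν`, as an extended
real number; for `ν = volume` it is the negative of the differential entropy. The value is `⊤`
also when the log-likelihood ratio is not `μ`-integrable, which is the natural convention only if
its negative part is integrable. -/
noncomputable def negEntropy (μ ν : Measure X) : EReal :=
  if μ ≪ ν ∧ Integrable (llr μ ν) μ then ((∫ x, llr μ ν x ∂μ : ℝ) : EReal) else ⊤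

theorem negEntropy_lt_top_iff : negEntropy μ ν < ⊤ ↔ μ ≪ ν ∧ Integrable (llr μ ν) μ := by
  unfold negEntropy
  split_ifs with h <;> simp [h, EReal.coe_lt_top]

theorem negEntropy_of_lt_top (h : negEntropy μ ν < ⊤) :
    negEntropy μ ν = ((∫ x, llr μ ν x ∂μ : ℝ) : EReal) :=
  if_pos (negEntropy_lt_top_iff.1 h)

theorem coe_klDiv_eq_negEntropy [IsProbabilityMeasure μ] [IsProbabilityMeasure ν] :
    (klDiv μ ν : EReal) = negEntropy μ ν := by
  by_cases h : μ ≪ ν ∧ Integrable (llr μ ν) μ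
  · rw [negEntropy, if_pos h, ← toReal_klDiv_of_measure_eq h.1 (by simp),
      EReal.coe_ennreal_toReal (klDiv_ne_top h.1 h.2)]
  · rw [negEntropy, if_neg h, klDiv_eq_top_iff.2 (not_and.1 h), EReal.coe_ennreal_top]

theorem negEntropy_tilted [IsProbabilityMeasure μ] [SigmaFinite ν] {f : X → ℝ}
    (hfμ : Integrable f μ) (hfν : Integrable (fun x => Real.exp (f x)) ν) :
    negEntropy μ (ν.tilted f) =
      negEntropy μ ν + ((Real.log (∫ x, Real.exp (f x) ∂ν) - ∫ x, f x ∂μ : ℝ) : EReal) := by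
  have hac : μ ≪ ν.tilted f ↔ μ ≪ ν :=
    ⟨fun h => h.trans (tilted_absolutelyContinuous ν f),
      fun h => h.trans (absolutelyContinuous_tilted hfν)⟩
  have hint (h : μ ≪ ν) : Integrable (llr μ (ν.tilted f)) μ ↔ Integrable (llr μ ν) μ := by
    rw [integrable_congr (llr_tilted_right h hfν)]
    exact integrable_add_iff_integrable_right (hfμ.neg.add (integrable_const _))
  by_cases h : μ ≪ ν ∧ Integrable (llr μ ν) μ
  · rw [negEntropy, negEntropy, if_pos h, if_pos ⟨hac.2 h.1, (hint h.1).2 h.2⟩,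
      integral_llr_tilted_right h.1 hfμ hfν h.2, ← EReal.coe_add]
    ring_nf
  · have h' : ¬ (μ ≪ ν.tilted f ∧ Integrable (llr μ (ν.tilted f)) μ) := fun h' =>
      h ⟨hac.1 h'.1, (hint (hac.1 h'.1)).1 h'.2⟩
    rw [negEntropy, negEntropy, if_neg h, if_neg h', EReal.top_add_coe]

end RelativeEntropy

section DonskerVaradhan

/-- The real number `t` forced into the interval `[(N + 1)⁻¹, N + 1]`, so that its logarithm is
bounded. -/
noncomputable def clamp (N : ℕ) (t : ℝ) : ℝ := max ((N : ℝ) + 1)⁻¹ (min t (N + 1))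

theorem continuous_clamp (N : ℕ) : Continuous (clamp N) := by
  unfold clamp
  fun_prop

theorem clamp_pos (N : ℕ) (t : ℝ) : 0 < clamp N t :=
  lt_max_of_lt_left (by positivity)

theorem clamp_le (N : ℕ) (t : ℝ) : clamp N t ≤ N + 1 :=
  have hN : (1 : ℝ) ≤ N + 1 := le_add_of_nonneg_left N.cast_nonneg
  max_le ((inv_le_one_of_one_le₀ hN).trans hN) (min_le_right _ _)

theorem abs_log_clamp_le (N : ℕ) (t : ℝ) : |Real.log (clamp N t)| ≤ Real.log (N + 1) := by
  refine abs_le.2 ⟨?_, Real.log_le_log (clamp_pos N t) (clamp_le N t)⟩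
  rw [← Real.log_inv]
  exact Real.log_le_log (by positivity) (le_max_left _ _)

theorem tendsto_clamp {t : ℝ} (ht : 0 ≤ t) : Tendsto (fun N => clamp N t) atTop (𝓝 t) := by
  have hmin : Tendsto (fun N : ℕ => min t (N + 1)) atTop (𝓝 t) :=
    tendsto_const_nhds.congr' <| (eventually_ge_atTop ⌈t⌉₊).mono fun N hN =>
      (min_eq_left ((Nat.ceil_le.1 hN).trans (le_add_of_nonneg_right zero_le_one))).symm
  have hinv : Tendsto (fun N : ℕ => ((N : ℝ) + 1)⁻¹) atTop (𝓝 0) := by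
    simpa only [one_div] using tendsto_one_div_add_atTop_nhds_zero_nat (𝕜 := ℝ)
  simpa only [clamp, max_eq_right ht] using hinv.max hmin

theorem klFun_clamp_le (N : ℕ) (t : ℝ) :
    klFun (clamp N t) ≤ t * Real.log (clamp N t) + 1 - clamp N t := by
  have hN : (1 : ℝ) ≤ N + 1 := le_add_of_nonneg_left N.cast_nonneg
  have hinv : ((N : ℝ) + 1)⁻¹ ≤ 1 := inv_le_one_of_one_le₀ hN
  suffices 0 ≤ (t - clamp N t) * Real.log (clamp N t) by
    rw [klFun_apply]
    linarith
  rcases le_total t (N + 1) with ht | ht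
  · rcases le_total ((N : ℝ) + 1)⁻¹ t with ht' | ht'
    · simp [clamp, ht, ht']
    · rw [clamp, min_eq_left ht, max_eq_left ht']
      exact mul_nonneg_of_nonpos_of_nonpos (by linarith)
        (Real.log_nonpos (by positivity) hinv)
  · rw [clamp, min_eq_right ht, max_eq_right (hinv.trans hN)]
    exact mul_nonneg (by linarith) (Real.log_nonneg hN)

theorem tendsto_mul_log_clamp {t : ℝ} (ht : 0 ≤ t) :
    Tendsto (fun N => t * Real.log (clamp N t) + 1 - clamp N t) atTop (𝓝 (klFun t)) := by
  refine Tendsto.sub (Tendsto.add ?_ tendsto_const_nhds) (tendsto_clamp ht)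
  rcases ht.eq_or_lt with rfl | ht
  · simp
  · exact ((Real.continuousAt_log ht.ne').tendsto.comp (tendsto_clamp ht.le)).const_mul t

variable {X : Type*} [MeasurableSpace X] {μ ν : Measure X}

/-- The functional `g ↦ ∫ g dμ - ∫ (exp g - 1) dν`, whose supremum over bounded functions is the
relative entropy `klDiv μ ν` of finite measures. -/
noncomputable def dvFunctional (μ ν : Measure X) (g : X → ℝ) : ℝ :=
  ∫ x, g x ∂μ - ∫ x, (Real.exp (g x) - 1) ∂ν

theorem klDiv_le_liminf_lintegral_clamp [IsFiniteMeasure μ] [IsFiniteMeasure ν] (hμν : μ ≪ ν) :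
    klDiv μ ν ≤ liminf (fun N => ∫⁻ x, ENNReal.ofReal ((μ.rnDeriv ν x).toReal *
      Real.log (clamp N (μ.rnDeriv ν x).toReal) + 1 - clamp N (μ.rnDeriv ν x).toReal) ∂ν)
      atTop := by
  have hmeas (N : ℕ) : Measurable fun x => clamp N (μ.rnDeriv ν x).toReal :=
    (continuous_clamp N).measurable.comp (Measure.measurable_rnDeriv μ ν).ennreal_toReal
  rw [klDiv_eq_lintegral_klFun_of_ac hμν]
  refine (lintegral_mono fun x => ?_).trans (lintegral_liminf_le fun N => by fun_prop)
  exact (ENNReal.tendsto_ofReal (tendsto_mul_log_clamp ENNReal.toReal_nonneg)).liminf_eq.ge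

theorem lintegral_clamp_eq_dvFunctional [IsFiniteMeasure μ] [IsFiniteMeasure ν] (hμν : μ ≪ ν)
    (N : ℕ) :
    ∫⁻ x, ENNReal.ofReal ((μ.rnDeriv ν x).toReal *
      Real.log (clamp N (μ.rnDeriv ν x).toReal) + 1 - clamp N (μ.rnDeriv ν x).toReal) ∂ν =
      ENNReal.ofReal
        (dvFunctional μ ν fun x => Real.log (clamp N (μ.rnDeriv ν x).toReal)) := by
  set f : X → ℝ := fun x => (μ.rnDeriv ν x).toReal
  have hclamp : Measurable fun x => clamp N (f x) :=
    (continuous_clamp N).measurable.comp (Measure.measurable_rnDeriv μ ν).ennreal_toReal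
  have hlog : Integrable (fun x => f x * Real.log (clamp N (f x))) ν :=
    Measure.integrable_toReal_rnDeriv.mul_bdd hclamp.log.aestronglyMeasurable
      (ae_of_all _ fun x => abs_log_clamp_le N _)
  have hexp : Integrable (fun x => clamp N (f x) - 1) ν := by
    refine Integrable.sub (Integrable.of_bound hclamp.aestronglyMeasurable (N + 1)
      (ae_of_all _ fun x => ?_)) (integrable_const 1)
    rw [Real.norm_of_nonneg (clamp_pos N _).le]
    exact clamp_le N _
  have hsplit : (fun x => f x * Real.log (clamp N (f x)) + 1 - clamp N (f x)) =
      fun x => f x * Real.log (clamp N (f x)) - (clamp N (f x) - 1) := by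
    ext x
    ring
  rw [← ofReal_integral_eq_lintegral_ofReal, hsplit, integral_sub hlog hexp, dvFunctional]
  · simp_rw [Real.exp_log (clamp_pos N _), ← integral_rnDeriv_smul hμν, smul_eq_mul, f]
  · exact hsplit ▸ hlog.sub hexp
  · exact ae_of_all _ fun x => (klFun_nonneg (clamp_pos N _).le).trans (klFun_clamp_le N _)

theorem exists_dvFunctional_gt_of_not_ac [IsFiniteMeasure μ] (h : ¬ μ ≪ ν) (c : ℝ) :
    ∃ (g : X → ℝ) (M : ℝ), Measurable g ∧ (∀ x, |g x| ≤ M) ∧ c < dvFunctional μ ν g := by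
  obtain ⟨A, hA, hνA, hμA⟩ : ∃ A, MeasurableSet A ∧ ν A = 0 ∧ μ A ≠ 0 := by
    by_contra! hcon
    exact h (Measure.AbsolutelyContinuous.mk fun s hs h0 => hcon s hs h0)
  have hA0 : μ.real A ≠ 0 := (ENNReal.toReal_pos hμA (measure_ne_top _ _)).ne'
  set M := (c + 1) / μ.real A
  refine ⟨A.indicator fun _ => M, |M|, measurable_const.indicator hA, fun x => ?_, ?_⟩
  · by_cases hx : x ∈ A <;> simp [hx]
  · have hexp : (fun x => Real.exp (A.indicator (fun _ => M) x) - 1) =ᵐ[ν] 0 := by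
      filter_upwards [measure_eq_zero_iff_ae_notMem.1 hνA] with x hx
      simp [hx]
    rw [dvFunctional, integral_congr_ae hexp, integral_indicator_const _ hA, smul_eq_mul,
      mul_div_cancel₀ _ hA0]
    simp

theorem exists_measurable_lt_dvFunctional [IsFiniteMeasure μ] [IsFiniteMeasure ν] {c : ℝ}
    (h : ENNReal.ofReal c < klDiv μ ν) :
    ∃ (g : X → ℝ) (M : ℝ), Measurable g ∧ (∀ x, |g x| ≤ M) ∧ c < dvFunctional μ ν g := by
  by_cases hμν : μ ≪ ν
  · obtain ⟨N, hN⟩ := (eventually_lt_of_lt_liminf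
      (h.trans_le (klDiv_le_liminf_lintegral_clamp hμν))).exists
    rw [lintegral_clamp_eq_dvFunctional hμν] at hN
    exact ⟨_, Real.log (N + 1), ((continuous_clamp N).measurable.comp
      (Measure.measurable_rnDeriv μ ν).ennreal_toReal).log, fun x => abs_log_clamp_le N _,
      (ENNReal.ofReal_lt_ofReal_iff'.1 hN).1⟩
  · exact exists_dvFunctional_gt_of_not_ac hμν c

theorem tendsto_dvFunctional [IsFiniteMeasure μ] [IsFiniteMeasure ν] {ψ : ℕ → X → ℝ} {g : X → ℝ}
    {M : ℝ} (hψ : ∀ n, Measurable (ψ n)) (hM : ∀ n x, |ψ n x| ≤ M)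
    (hμ : ∀ᵐ x ∂μ, Tendsto (fun n => ψ n x) atTop (𝓝 (g x)))
    (hν : ∀ᵐ x ∂ν, Tendsto (fun n => ψ n x) atTop (𝓝 (g x))) :
    Tendsto (fun n => dvFunctional μ ν (ψ n)) atTop (𝓝 (dvFunctional μ ν g)) := by
  refine Tendsto.sub ?_ ?_
  · exact tendsto_integral_of_dominated_convergence (fun _ => M)
      (fun n => (hψ n).aestronglyMeasurable) (integrable_const M) (fun n => ae_of_all _ (hM n)) hμ
  · refine tendsto_integral_of_dominated_convergence (fun _ => Real.exp M + 1)
      (fun n => ((hψ n).exp.sub_const 1).aestronglyMeasurable) (integrable_const _)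
      (fun n => ae_of_all _ fun x => ?_) (hν.mono fun x hx => (hx.rexp.sub_const 1))
    refine (norm_sub_le _ _).trans (add_le_add ?_ norm_one.le)
    rw [Real.norm_of_nonneg (Real.exp_pos _).le]
    exact Real.exp_le_exp.2 (abs_le.1 (hM n x)).2

variable [TopologicalSpace X] [TopologicalSpace.PseudoMetrizableSpace X] [BorelSpace X]

theorem exists_seq_boundedContinuous_tendsto_ae [IsFiniteMeasure μ] {g : X → ℝ} {M : ℝ}
    (hg : Measurable g) (hM : ∀ x, |g x| ≤ M) :
    ∃ ψ : ℕ → X →ᵇ ℝ, (∀ n x, |ψ n x| ≤ M) ∧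
      ∀ᵐ x ∂μ, Tendsto (fun n => ψ n x) atTop (𝓝 (g x)) := by
  have hgi : MemLp g 1 μ := .of_bound hg.aestronglyMeasurable M (ae_of_all _ hM)
  choose φ hφ hφm using fun n : ℕ => hgi.exists_boundedContinuous_eLpNorm_sub_le ENNReal.one_ne_top
    (ENNReal.inv_ne_zero.2 (ENNReal.natCast_ne_top n))
  have hlim : Tendsto (fun n => eLpNorm (⇑(φ n) - g) 1 μ) atTop (𝓝 0) :=
    tendsto_of_tendsto_of_tendsto_of_le_of_le tendsto_const_nhds
      ENNReal.tendsto_inv_nat_nhds_zero (fun _ => zero_le)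
      fun n => (eLpNorm_sub_comm _ _ _ _).trans_le (hφ n)
  obtain ⟨ns, -, hns⟩ := (tendstoInMeasure_of_tendsto_eLpNorm one_ne_zero
    (fun n => (hφm n).aestronglyMeasurable) hgi.aestronglyMeasurable hlim).exists_seq_tendsto_ae
  have hbd (n : ℕ) (x : X) : |max (-M) (min M (φ (ns n) x))| ≤ M :=
    abs_le.2 ⟨le_max_left _ _, max_le (neg_le_self ((abs_nonneg _).trans (hM x)))
      (min_le_left _ _)⟩
  refine ⟨fun n => .ofNormedAddCommGroup _ (by fun_prop) M (hbd n), hbd, hns.mono fun x hx => ?_⟩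
  have hgx := abs_le.1 (hM x)
  have := (tendsto_const_nhds (x := -M)).max ((tendsto_const_nhds (x := M)).min hx)
  rwa [min_eq_right hgx.2, max_eq_right hgx.1] at this

theorem exists_boundedContinuous_lt_dvFunctional [IsFiniteMeasure μ] [IsFiniteMeasure ν] {c : ℝ}
    (h : (c : EReal) < klDiv μ ν) : ∃ g : X →ᵇ ℝ, c < dvFunctional μ ν g := by
  rcases lt_or_ge c 0 with hc | hc
  · exact ⟨0, by simpa [dvFunctional] using hc⟩
  · rw [← max_eq_left hc, ← EReal.coe_ennreal_ofReal, EReal.coe_ennreal_lt_coe_ennreal_iff] at h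
    obtain ⟨g, M, hg, hM, hlt⟩ := exists_measurable_lt_dvFunctional h
    obtain ⟨ψ, hψM, hψ⟩ := exists_seq_boundedContinuous_tendsto_ae (μ := μ + ν) hg hM
    obtain ⟨hμ, hν⟩ := (ae_add_measure_iff).1 hψ
    obtain ⟨n, hn⟩ := ((tendsto_dvFunctional (fun n => (ψ n).continuous.measurable) hψM
      hμ hν).eventually (lt_mem_nhds hlt)).exists
    exact ⟨ψ n, hn⟩

end DonskerVaradhan

section StrictConvexity

theorem coe_mul_ofReal_add_coe_mul_ofReal (a b : ℝ≥0) {s t : ℝ} (hs : 0 ≤ s) (ht : 0 ≤ t) :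
    a * ENNReal.ofReal s + b * ENNReal.ofReal t = ENNReal.ofReal (a * s + b * t) := by
  rw [ENNReal.ofReal_add (by positivity) (by positivity), ENNReal.ofReal_mul a.coe_nonneg,
    ENNReal.ofReal_mul b.coe_nonneg, ENNReal.ofReal_coe_nnreal, ENNReal.ofReal_coe_nnreal]

theorem ofReal_klFun_lt {s t : ℝ} (hs : 0 ≤ s) (ht : 0 ≤ t) (hst : s ≠ t) {a b : ℝ≥0}
    (hab : a + b = 1) (ha : 0 < a) (hb : 0 < b) :
    ENNReal.ofReal (klFun (a * s + b * t)) < ENNReal.ofReal (a * klFun s + b * klFun t) :=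
  (ENNReal.ofReal_lt_ofReal_iff_of_nonneg (klFun_nonneg (by positivity))).2
    (strictConvexOn_klFun.2 hs ht hst (NNReal.coe_pos.2 ha) (NNReal.coe_pos.2 hb) (mod_cast hab))

variable {X : Type*} [MeasurableSpace X] {μ ν ρ : Measure X}

theorem toReal_rnDeriv_add_smul [IsFiniteMeasure μ] [IsFiniteMeasure ν] [SigmaFinite ρ]
    (a b : ℝ≥0) : ∀ᵐ x ∂ρ, ((a • μ + b • ν).rnDeriv ρ x).toReal =
      a * (μ.rnDeriv ρ x).toReal + b * (ν.rnDeriv ρ x).toReal := by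
  filter_upwards [Measure.rnDeriv_add (a • μ) (b • ν) ρ, Measure.rnDeriv_smul_left μ ρ a,
    Measure.rnDeriv_smul_left ν ρ b, Measure.rnDeriv_lt_top μ ρ, Measure.rnDeriv_lt_top ν ρ]
    with x hadd ha hb hμ hν
  rw [hadd, Pi.add_apply, ha, hb, Pi.smul_apply, Pi.smul_apply, ENNReal.smul_def,
    ENNReal.smul_def, smul_eq_mul, smul_eq_mul, ENNReal.toReal_add (by finiteness) (by finiteness)]
  simp

theorem klDiv_add_smul_lt [IsFiniteMeasure μ] [IsFiniteMeasure ν] [IsFiniteMeasure ρ]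
    (hne : μ ≠ ν) (hμ : klDiv μ ρ ≠ ∞) (hν : klDiv ν ρ ≠ ∞) {a b : ℝ≥0} (hab : a + b = 1)
    (ha : 0 < a) (hb : 0 < b) : klDiv (a • μ + b • ν) ρ < a * klDiv μ ρ + b * klDiv ν ρ := by
  have hμac := (klDiv_ne_top_iff.1 hμ).1
  have hνac := (klDiv_ne_top_iff.1 hν).1
  set f : X → ℝ := fun x => (μ.rnDeriv ρ x).toReal
  set g : X → ℝ := fun x => (ν.rnDeriv ρ x).toReal
  have hf (x : X) : f x ∈ Ici (0 : ℝ) := ENNReal.toReal_nonneg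
  have hg (x : X) : g x ∈ Ici (0 : ℝ) := ENNReal.toReal_nonneg
  have hmix : klDiv (a • μ + b • ν) ρ = ∫⁻ x, ENNReal.ofReal (klFun (a * f x + b * g x)) ∂ρ := by
    rw [klDiv_eq_lintegral_klFun_of_ac ((hμac.smul_left a).add_left (hνac.smul_left b))]
    exact lintegral_congr_ae ((toReal_rnDeriv_add_smul (μ := μ) (ν := ν) a b).mono
      fun x hx => congrArg (fun t => ENNReal.ofReal (klFun t)) hx)
  have hsum : a * klDiv μ ρ + b * klDiv ν ρ =
      ∫⁻ x, ENNReal.ofReal (a * klFun (f x) + b * klFun (g x)) ∂ρ := by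
    rw [klDiv_eq_lintegral_klFun_of_ac hμac, klDiv_eq_lintegral_klFun_of_ac hνac,
      ← lintegral_const_mul _ (by fun_prop), ← lintegral_const_mul _ (by fun_prop),
      ← lintegral_add_left (by fun_prop)]
    exact lintegral_congr fun x => coe_mul_ofReal_add_coe_mul_ofReal a b
      (klFun_nonneg (hf x)) (klFun_nonneg (hg x))
  have hfin : a * klDiv μ ρ + b * klDiv ν ρ ≠ ∞ := by finiteness
  have hle (x : X) : ENNReal.ofReal (klFun (a * f x + b * g x)) ≤
      ENNReal.ofReal (a * klFun (f x) + b * klFun (g x)) := ENNReal.ofReal_le_ofReal <|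
    convexOn_klFun.2 (hf x) (hg x) a.coe_nonneg b.coe_nonneg (mod_cast hab)
  rw [hsum] at hfin ⊢
  rw [hmix]
  refine lintegral_strict_mono_of_ae_le_of_frequently_ae_lt (by fun_prop)
    (ne_top_of_le_ne_top hfin (lintegral_mono hle)) (ae_of_all _ hle) fun hcon => hne ?_
  rw [← Measure.withDensity_rnDeriv_eq _ _ hμac, ← Measure.withDensity_rnDeriv_eq _ _ hνac]
  refine withDensity_congr_ae ?_
  filter_upwards [hcon, Measure.rnDeriv_lt_top μ ρ, Measure.rnDeriv_lt_top ν ρ] with x hx hfx hgx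
  by_contra hfg
  exact hx (ofReal_klFun_lt (hf x) (hg x) (mt (ENNReal.toReal_eq_toReal_iff' hfx.ne hgx.ne).1 hfg)
    hab ha hb).ne

end StrictConvexity

section MomentBall

theorem abs_sub_max_min_le {t M r : ℝ} (hM : 0 ≤ M) (hr : 0 ≤ r) (h : |t| ≤ M ∨ |t| ≤ r) :
    |t - max (-M) (min M t)| ≤ r := by
  grind

variable {X : Type*} [TopologicalSpace X] {V φ : X → ℝ} {R : ℝ}

theorem exists_abs_le_of_isLittleO (h0 : ∀ x, 0 ≤ V x) (hφ : Continuous φ)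
    (ho : φ =o[cocompact X] V) {ε : ℝ} (hε : 0 < ε) :
    ∃ M, 0 ≤ M ∧ ∀ x, |φ x| ≤ M ∨ |φ x| ≤ ε * V x := by
  obtain ⟨K, hK, hKφ⟩ := mem_cocompact.1 (Asymptotics.isLittleO_iff.1 ho hε)
  obtain ⟨M, hM⟩ := hK.exists_bound_of_continuousOn hφ.continuousOn
  refine ⟨max M 0, le_max_right _ _, fun x => ?_⟩
  by_cases hx : x ∈ K
  · exact Or.inl ((hM x hx).trans (le_max_left _ _))
  · simpa [Real.norm_eq_abs, abs_of_nonneg (h0 x)] using Or.inr (hKφ hx)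

variable [MeasurableSpace X]

/-- The set of probability measures `μ` with `∫ V dμ ≤ R`, for `V ≥ 0` and `R ≥ 0`; on `ℝ` this is
the set where `moment V μ ≤ R`. -/
def momentBall (V : X → ℝ) (R : ℝ) : Set (ProbabilityMeasure X) :=
  {μ | ∫⁻ x, ENNReal.ofReal (V x) ∂(μ : Measure X) ≤ ENNReal.ofReal R}

theorem lowerSemicontinuous_lintegral [OpensMeasurableSpace X] (hV : Continuous V) :
    LowerSemicontinuous fun μ : ProbabilityMeasure X =>
      ∫⁻ x, ENNReal.ofReal (V x) ∂(μ : Measure X) := by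
  have htrunc (N : ℕ) : ∃ f : X →ᵇ ℝ≥0, ∀ x, f x = min (V x).toNNReal N :=
    ⟨.mkOfBound ⟨fun x => min (V x).toNNReal N, by fun_prop⟩ N fun x y =>
      abs_sub_le_of_nonneg_of_le (NNReal.coe_nonneg _) (mod_cast min_le_right _ _)
        (NNReal.coe_nonneg _) (mod_cast min_le_right _ _), fun _ => rfl⟩
  choose f hf using htrunc
  have hsup (x : X) : ENNReal.ofReal (V x) = ⨆ N, (f N x : ℝ≥0∞) := by
    simp_rw [hf, ENNReal.ofReal]
    obtain ⟨N, hN⟩ := exists_nat_ge (V x).toNNReal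
    exact le_antisymm (le_iSup_of_le N (by rw [min_eq_left hN]))
      (iSup_le fun N => ENNReal.coe_le_coe.2 (min_le_left _ _))
  have hmono : Monotone fun N x => (f N x : ℝ≥0∞) := fun N M hNM x => by
    simpa only [hf] using ENNReal.coe_le_coe.2 (min_le_min_left _ (Nat.cast_le.2 hNM))
  simp_rw [hsup, lintegral_iSup (fun N => (by fun_prop : Measurable fun x => (f N x : ℝ≥0∞))) hmono]
  refine lowerSemicontinuous_iSup fun N => Continuous.lowerSemicontinuous ?_
  exact (ENNReal.continuous_coe.comp (ProbabilityMeasure.continuous_testAgainstNN_eval (f N))).congr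
    fun μ => FiniteMeasure.testAgainstNN_coe_eq

theorem isClosed_momentBall [OpensMeasurableSpace X] (hV : Continuous V) :
    IsClosed (momentBall V R) :=
  (lowerSemicontinuous_lintegral hV).isClosed_preimage _

theorem isTightMeasureSet_momentBall [OpensMeasurableSpace X] (hV : Continuous V)
    (htop : Tendsto V (cocompact X) atTop) :
    IsTightMeasureSet {((μ : ProbabilityMeasure X) : Measure X) | μ ∈ momentBall V R} := by
  refine isTightMeasureSet_iff_exists_isCompact_measure_compl_le.2 fun ε hε => ?_
  have hdiv : Tendsto (fun M => ENNReal.ofReal R / ENNReal.ofReal M) atTop (𝓝 0) := by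
    simpa using ENNReal.Tendsto.const_div ENNReal.tendsto_ofReal_atTop
      (Or.inr ENNReal.ofReal_ne_top)
  obtain ⟨M, hMε, hM⟩ := ((hdiv.eventually (ge_mem_nhds hε)).and (eventually_gt_atTop 0)).exists
  obtain ⟨K, hK, hKM⟩ := mem_cocompact.1 (htop.eventually_ge_atTop M)
  refine ⟨K, hK, ?_⟩
  rintro _ ⟨μ, hμ, rfl⟩
  calc (μ : Measure X) Kᶜ
      ≤ (μ : Measure X) {x | ENNReal.ofReal M ≤ ENNReal.ofReal (V x)} :=
        measure_mono fun x hx => ENNReal.ofReal_le_ofReal (hKM hx)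
    _ ≤ (∫⁻ x, ENNReal.ofReal (V x) ∂(μ : Measure X)) / ENNReal.ofReal M :=
        meas_ge_le_lintegral_div (by fun_prop) (ENNReal.ofReal_pos.2 hM).ne' ENNReal.ofReal_ne_top
    _ ≤ ENNReal.ofReal R / ENNReal.ofReal M := ENNReal.div_le_div_right hμ _
    _ ≤ ε := hMε

theorem isCompact_momentBall [T2Space X] [BorelSpace X] (hV : Continuous V)
    (htop : Tendsto V (cocompact X) atTop) : IsCompact (momentBall V R) := by
  rw [← (isClosed_momentBall hV).closure_eq]
  exact isCompact_closure_of_isTightMeasureSet (isTightMeasureSet_momentBall hV htop)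

section Integral

variable [OpensMeasurableSpace X] {μ : ProbabilityMeasure X}

theorem integrable_of_mem_momentBall (hV : Continuous V) (h0 : ∀ x, 0 ≤ V x)
    (hμ : μ ∈ momentBall V R) : Integrable V (μ : Measure X) :=
  (lintegral_ofReal_ne_top_iff_integrable hV.measurable.aestronglyMeasurable (ae_of_all _ h0)).1
    (ne_top_of_le_ne_top ENNReal.ofReal_ne_top hμ)

theorem integral_le_of_mem_momentBall (hV : Continuous V) (h0 : ∀ x, 0 ≤ V x) (hR : 0 ≤ R)
    (hμ : μ ∈ momentBall V R) : ∫ x, V x ∂(μ : Measure X) ≤ R := by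
  rw [integral_eq_lintegral_of_nonneg_ae (ae_of_all _ h0) hV.measurable.aestronglyMeasurable]
  exact ENNReal.toReal_le_of_le_ofReal hR hμ

theorem integrable_of_isLittleO (hV : Continuous V) (h0 : ∀ x, 0 ≤ V x) (hφ : Continuous φ)
    (ho : φ =o[cocompact X] V) (hμ : μ ∈ momentBall V R) : Integrable φ (μ : Measure X) := by
  obtain ⟨M, hM0, hM⟩ := exists_abs_le_of_isLittleO h0 hφ ho one_pos
  refine ((integrable_const M).add (integrable_of_mem_momentBall hV h0 hμ)).mono'
    hφ.measurable.aestronglyMeasurable (ae_of_all _ fun x => ?_)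
  rw [Pi.add_apply, Real.norm_eq_abs]
  rcases hM x with h | h <;> linarith [h0 x]

theorem continuous_integral_of_abs_le (hφ : Continuous φ) {M : ℝ} (hM : ∀ x, |φ x| ≤ M) :
    Continuous fun μ : ProbabilityMeasure X => ∫ x, φ x ∂(μ : Measure X) :=
  ProbabilityMeasure.continuous_integral_boundedContinuousFunction
    (BoundedContinuousFunction.ofNormedAddCommGroup φ hφ M hM)

theorem continuousOn_integral_momentBall (hV : Continuous V) (h0 : ∀ x, 0 ≤ V x) (hR : 0 ≤ R)
    (hφ : Continuous φ) (ho : φ =o[cocompact X] V) :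
    ContinuousOn (fun μ : ProbabilityMeasure X => ∫ x, φ x ∂(μ : Measure X)) (momentBall V R) := by
  refine continuousOn_of_uniform_approx_of_continuousOn fun u hu => ?_
  obtain ⟨δ, hδ, hδu⟩ := Metric.mem_uniformity_dist.1 hu
  obtain ⟨ε, hε, hεδ⟩ := exists_pos_mul_lt hδ R
  obtain ⟨M, hM0, hM⟩ := exists_abs_le_of_isLittleO h0 hφ ho hε
  let ψ (x : X) : ℝ := max (-M) (min M (φ x))
  have hψ : Continuous ψ := by fun_prop
  have hψM (x : X) : |ψ x| ≤ M :=
    abs_le.2 ⟨le_max_left _ _, max_le (by linarith) (min_le_left _ _)⟩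
  refine ⟨fun μ => ∫ x, ψ x ∂(μ : Measure X), (continuous_integral_of_abs_le hψ hψM).continuousOn,
    fun μ hμ => hδu ?_⟩
  have hψi : Integrable ψ (μ : Measure X) :=
    Integrable.of_bound hψ.measurable.aestronglyMeasurable M (ae_of_all _ hψM)
  rw [Real.dist_eq, ← integral_sub (integrable_of_isLittleO hV h0 hφ ho hμ) hψi]
  calc ‖∫ x, (φ x - ψ x) ∂(μ : Measure X)‖
      ≤ ∫ x, ε * V x ∂(μ : Measure X) :=
        norm_integral_le_of_norm_le ((integrable_of_mem_momentBall hV h0 hμ).const_mul ε)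
          (ae_of_all _ fun x => abs_sub_max_min_le hM0 (mul_nonneg hε.le (h0 x)) (hM x))
    _ = ε * ∫ x, V x ∂(μ : Measure X) := integral_const_mul _ _
    _ ≤ ε * R := mul_le_mul_of_nonneg_left (integral_le_of_mem_momentBall hV h0 hR hμ) hε.le
    _ < δ := by rwa [mul_comm]

end Integral

end MomentBall

section Minimum

theorem exists_neg_deriv_eq_zero {g : ℝ → ℝ} (hg : ContinuousOn g (Iio 0))
    (h0 : Tendsto g (𝓝[<] 0) atTop) (hbot : Tendsto g atBot atTop) : ∃ α < 0, deriv g α = 0 := by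
  have hneg (t : ℝ) : -Real.exp t ∈ Iio 0 := neg_lt_zero.2 (Real.exp_pos t)
  have hatBot : Tendsto (fun t : ℝ => -Real.exp t) atBot (𝓝[<] 0) :=
    tendsto_nhdsWithin_iff.2
      ⟨by simpa using Real.tendsto_exp_atBot.neg, Eventually.of_forall hneg⟩
  have hcont : Continuous fun t : ℝ => g (-Real.exp t) :=
    hg.comp_continuous (by fun_prop) hneg
  obtain ⟨t, ht⟩ := hcont.exists_forall_le (by
    rw [cocompact_eq_atBot_atTop, tendsto_sup]
    exact ⟨h0.comp hatBot, hbot.comp (tendsto_neg_atTop_atBot.comp Real.tendsto_exp_atTop)⟩)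
  refine ⟨_, hneg t, IsLocalMin.deriv_eq_zero ?_⟩
  filter_upwards [Iio_mem_nhds (hneg t)] with β hβ
  simpa only [Real.exp_log (neg_pos.2 hβ), neg_neg] using ht (Real.log (-β))

theorem integrable_exp_neg_mul_abs {b : ℝ} (hb : 0 < b) :
    Integrable fun x : ℝ => Real.exp (-b * |x|) := by
  have h : IntegrableOn (fun x : ℝ => Real.exp (-b * |x|)) (Ioi 0) :=
    (exp_neg_integrableOn_Ioi 0 hb).congr_fun
      (fun x hx => by simp [abs_of_pos (mem_Ioi.1 hx)]) measurableSet_Ioi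
  have h' : IntegrableOn (fun x : ℝ => Real.exp (-b * |x|)) (Iic 0) :=
    (integrableOn_exp_mul_Iic hb 0).congr_fun
      (fun x hx => by simp [abs_of_nonpos (mem_Iic.1 hx)]) measurableSet_Iic
  rw [← integrableOn_univ, ← Iic_union_Ioi (a := (0:ℝ))]
  exact h'.union h

end Minimum

namespace IsOrlicz

variable {V : ℝ → ℝ}

theorem nonneg (hV : IsOrlicz V) (x : ℝ) : 0 ≤ V x := by
  rcases eq_or_ne x 0 with rfl | hx
  · exact hV.zero.ge
  · exact (hV.pos x hx).le

theorem continuous (hV : IsOrlicz V) : Continuous V :=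
  continuousOn_univ.1 (by simpa using hV.convex.continuousOn_interior)

theorem integral_eq_toReal_moment (hV : IsOrlicz V) (μ : ProbabilityMeasure ℝ) :
    ∫ x, V x ∂(μ : Measure ℝ) = (moment V μ).toReal :=
  integral_eq_lintegral_of_nonneg_ae (ae_of_all _ hV.nonneg) hV.continuous.aestronglyMeasurable

theorem apply_abs (hV : IsOrlicz V) (x : ℝ) : V |x| = V x := by
  rcases abs_choice x with h | h <;> rw [h]
  exact hV.even x

theorem apply_mul_le (hV : IsOrlicz V) {t : ℝ} (h0 : 0 ≤ t) (h1 : t ≤ 1) (x : ℝ) :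
    V (t * x) ≤ t * V x := by
  simpa [hV.zero] using hV.convex.2 (mem_univ x) (mem_univ 0) h0 (sub_nonneg.2 h1) (by ring)

theorem apply_le_of_abs_le (hV : IsOrlicz V) {x y : ℝ} (h : |x| ≤ |y|) : V x ≤ V y := by
  have hmul : |x| / |y| * |y| = |x| :=
    div_mul_cancel_of_imp fun hy => le_antisymm (hy ▸ h) (abs_nonneg x)
  have hle : |x| / |y| ≤ 1 := div_le_one_of_le₀ h (abs_nonneg y)
  have := hV.apply_mul_le (by positivity) hle |y|
  rw [hmul, hV.apply_abs, hV.apply_abs] at this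
  exact this.trans (mul_le_of_le_one_left (hV.nonneg y) hle)

theorem mul_abs_le (hV : IsOrlicz V) (x : ℝ) : V 1 * |x| ≤ V x + V 1 := by
  rcases le_total |x| 1 with h | h
  · nlinarith [hV.nonneg x, hV.nonneg 1]
  · have hx : 0 < |x| := by linarith
    have := hV.apply_mul_le (inv_nonneg.2 hx.le) (inv_le_one_of_one_le₀ h) |x|
    rw [inv_mul_cancel₀ hx.ne', hV.apply_abs, inv_mul_eq_div, le_div_iff₀ hx] at this
    linarith [hV.nonneg 1]

theorem tendsto_cocompact (hV : IsOrlicz V) : Tendsto V (cocompact ℝ) atTop := by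
  have hlin : Tendsto (fun x => V 1 * ‖x‖ + -V 1) (cocompact ℝ) atTop :=
    tendsto_atTop_add_const_right _ _
      (tendsto_norm_cocompact_atTop.const_mul_atTop (hV.pos 1 one_ne_zero))
  exact tendsto_atTop_mono (fun x => by
    rw [Real.norm_eq_abs]
    linarith [hV.mul_abs_le x]) hlin

theorem isCompact_momentBall (hV : IsOrlicz V) (R : ℝ) : IsCompact (momentBall V R) :=
  OrliczLDP.isCompact_momentBall hV.continuous hV.tendsto_cocompact

theorem integrable_exp_mul (hV : IsOrlicz V) {β : ℝ} (hβ : β < 0) :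
    Integrable fun x => Real.exp (β * V x) := by
  have hb : 0 < -β * V 1 := mul_pos (neg_pos.2 hβ) (hV.pos 1 one_ne_zero)
  have hmaj : Integrable fun x : ℝ => Real.exp (-β * V 1) * Real.exp (-(-β * V 1) * |x|) :=
    (integrable_exp_neg_mul_abs hb).const_mul _
  refine hmaj.mono' (by have := hV.continuous; fun_prop) (ae_of_all _ fun x => ?_)
  rw [Real.norm_of_nonneg (Real.exp_pos _).le, ← Real.exp_add, Real.exp_le_exp]
  nlinarith [hV.mul_abs_le x]

theorem mem_interior_integrableExpSet (hV : IsOrlicz V) {β : ℝ} (hβ : β < 0) :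
    β ∈ interior (integrableExpSet V volume) :=
  interior_maximal (fun _ hγ => hV.integrable_exp_mul hγ) isOpen_Iio hβ

theorem le_cgf (hV : IsOrlicz V) {β L : ℝ} (hβ : β < 0) (hL : 0 < L) :
    Real.log (2 * L) + β * V L ≤ cgf V volume β := by
  have hint := hV.integrable_exp_mul hβ
  rw [← Real.exp_le_exp, Real.exp_add, Real.exp_log (by positivity), exp_cgf hint]
  calc 2 * L * Real.exp (β * V L) = ∫ _ in Icc (-L) L, Real.exp (β * V L) := by
        simp [measureReal_def, ENNReal.toReal_ofReal, hL.le, two_mul]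
    _ ≤ ∫ x in Icc (-L) L, Real.exp (β * V x) :=
        setIntegral_mono_on (by simp) hint.integrableOn measurableSet_Icc fun x hx =>
          Real.exp_le_exp.2 (mul_le_mul_of_nonpos_left
            (hV.apply_le_of_abs_le ((abs_le.2 hx).trans (le_abs_self L))) hβ.le)
    _ ≤ mgf V volume β :=
        setIntegral_le_integral hint (ae_of_all _ fun x => (Real.exp_pos _).le)

theorem tendsto_cgf_sub_zero (hV : IsOrlicz V) (R : ℝ) :
    Tendsto (fun β => cgf V volume β - β * R) (𝓝[<] 0) atTop := by
  refine tendsto_atTop.2 fun C => ?_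
  set L := Real.exp (C + 1) / 2
  have hL : Real.log (2 * L) = C + 1 := by rw [mul_div_cancel₀ _ two_ne_zero, Real.log_exp]
  have hlim : Tendsto (fun β => β * (V L - R)) (𝓝[<] 0) (𝓝 0) :=
    tendsto_nhdsWithin_of_tendsto_nhds ((continuous_mul_const _).tendsto' 0 0 (zero_mul _))
  filter_upwards [hlim.eventually (lt_mem_nhds neg_one_lt_zero), self_mem_nhdsWithin] with β hC hβ
  linarith [hV.le_cgf hβ (L := L) (by positivity)]

theorem tendsto_cgf_sub_atBot (hV : IsOrlicz V) {R : ℝ} (hR : 0 < R) :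
    Tendsto (fun β => cgf V volume β - β * R) atBot atTop := by
  obtain ⟨L, hLR, hL⟩ : ∃ L, V L < R ∧ 0 < L :=
    (((hV.continuous.tendsto' 0 0 hV.zero).eventually (gt_mem_nhds hR)).filter_mono
      nhdsWithin_le_nhds |>.and (self_mem_nhdsWithin : Ioi 0 ∈ 𝓝[>] (0 : ℝ))).exists
  have hlin : Tendsto (fun β => Real.log (2 * L) + β * (V L - R)) atBot atTop :=
    tendsto_atTop_add_const_left _ _ (tendsto_id.atBot_mul_const_of_neg (sub_neg.2 hLR))
  refine tendsto_atTop_mono' _ ?_ hlin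
  filter_upwards [eventually_lt_atBot 0] with β hβ
  linarith [hV.le_cgf hβ hL]

theorem exists_deriv_cgf_eq (hV : IsOrlicz V) {R : ℝ} (hR : 0 < R) :
    ∃ α < 0, deriv (cgf V volume) α = R := by
  have hdiff {β : ℝ} (hβ : β < 0) : DifferentiableAt ℝ (cgf V volume) β :=
    (analyticAt_cgf (hV.mem_interior_integrableExpSet hβ)).differentiableAt
  obtain ⟨α, hα, hderiv⟩ := exists_neg_deriv_eq_zero (g := fun β => cgf V volume β - β * R)
    (fun β hβ => ((hdiff hβ).continuousAt.sub (by fun_prop)).continuousWithinAt)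
    (hV.tendsto_cgf_sub_zero R) (hV.tendsto_cgf_sub_atBot hR)
  refine ⟨α, hα, sub_eq_zero.1 ?_⟩
  rw [← hderiv, deriv_fun_sub (hdiff hα) (by fun_prop), deriv_mul_const_field, deriv_id'', one_mul]

theorem isProbabilityMeasure_gibbs (hV : IsOrlicz V) {β : ℝ} (hβ : β < 0) :
    IsProbabilityMeasure (gibbs V β) :=
  isProbabilityMeasure_tilted (hV.integrable_exp_mul hβ)

/-- The Gibbs measure, as a point of the space of probability measures. -/
noncomputable def gibbsPM (hV : IsOrlicz V) {β : ℝ} (hβ : β < 0) : ProbabilityMeasure ℝ :=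
  ⟨gibbs V β, hV.isProbabilityMeasure_gibbs hβ⟩

theorem moment_gibbsPM (hV : IsOrlicz V) {β : ℝ} (hβ : β < 0) :
    moment V (hV.gibbsPM hβ) = ENNReal.ofReal (deriv (cgf V volume) β) := by
  have hmem := hV.mem_interior_integrableExpSet hβ
  rw [← integral_tilted_mul_self hmem]
  exact (ofReal_integral_eq_lintegral_ofReal ((memLp_tilted_mul hmem 1).integrable le_rfl)
    (ae_of_all _ hV.nonneg)).symm

theorem gibbs_injOn (hV : IsOrlicz V) : InjOn (gibbs V) (Iio 0) := fun α hα β hβ h => by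
  have hcont := hV.continuous
  have := sub_eq_sub_of_tilted_eq (hcont.const_mul α) (hcont.const_mul β)
    (hV.integrable_exp_mul hα) (hV.integrable_exp_mul hβ) h 1 0
  simpa [hV.zero, (hV.pos 1 one_ne_zero).ne'] using this

end IsOrlicz

section Rate

variable {V : ℝ → ℝ} {R α : ℝ} {μ : ProbabilityMeasure ℝ}

theorem rate_of_mem_momentBall (hμ : μ ∈ momentBall V R) : rate V R α μ =
    klDiv (μ : Measure ℝ) (gibbs V α) + ENNReal.ofReal (α * ((moment V μ).toReal - R)) := if_pos hμ

theorem IsOrlicz.coe_klDiv_gibbs (hV : IsOrlicz V) (hα : α < 0)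
    (hVμ : Integrable V (μ : Measure ℝ)) :
    (klDiv (μ : Measure ℝ) (gibbs V α) : EReal) = negEntropy (μ : Measure ℝ) volume +
      ((cgf V volume α - α * ∫ x, V x ∂(μ : Measure ℝ) : ℝ) : EReal) := by
  have := hV.isProbabilityMeasure_gibbs hα
  rw [← integral_const_mul, coe_klDiv_eq_negEntropy]
  exact negEntropy_tilted (hVμ.const_mul α) (hV.integrable_exp_mul hα)

theorem IsOrlicz.coe_rate (hV : IsOrlicz V) (hR : 0 ≤ R) (hα : α < 0) (hμ : μ ∈ momentBall V R) :
    (rate V R α μ : EReal) =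
      negEntropy (μ : Measure ℝ) volume + ((cgf V volume α - α * R : ℝ) : EReal) := by
  have hVμ := integrable_of_mem_momentBall hV.continuous hV.nonneg hμ
  have hle := integral_le_of_mem_momentBall hV.continuous hV.nonneg hR hμ
  rw [rate_of_mem_momentBall hμ, EReal.coe_ennreal_add, hV.coe_klDiv_gibbs hα hVμ,
    ← hV.integral_eq_toReal_moment, EReal.coe_ennreal_ofReal,
    max_eq_left (mul_nonneg_of_nonpos_of_nonpos hα.le (sub_nonpos.2 hle)), add_assoc,
    ← EReal.coe_add]
  ring_nf

theorem IsOrlicz.rate_gibbsPM (hV : IsOrlicz V) (hR : 0 ≤ R) (hα : α < 0)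
    (hαR : deriv (cgf V volume) α = R) : rate V R α (hV.gibbsPM hα) = 0 := by
  have := hV.isProbabilityMeasure_gibbs hα
  have hm : moment V (hV.gibbsPM hα) = ENNReal.ofReal R := by rw [hV.moment_gibbsPM, hαR]
  rw [rate_of_mem_momentBall hm.le, hm, ENNReal.toReal_ofReal hR, sub_self, mul_zero,
    ENNReal.ofReal_zero, add_zero]
  exact klDiv_self _

theorem mem_momentBall_of_rate_lt_top (hμ : rate V R α μ < ∞) : μ ∈ momentBall V R := by
  by_contra h
  exact hμ.ne (if_neg h)

theorem IsOrlicz.eq_gibbs_of_rate_eq_zero (hV : IsOrlicz V) (hα : α < 0)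
    (h : rate V R α μ = 0) : (μ : Measure ℝ) = gibbs V α := by
  have := hV.isProbabilityMeasure_gibbs hα
  rw [rate_of_mem_momentBall (mem_momentBall_of_rate_lt_top (h ▸ ENNReal.zero_lt_top)),
    add_eq_zero, klDiv_eq_zero_iff] at h
  exact h.1

theorem moment_mix (V : ℝ → ℝ) {a b : ℝ≥0} (hab : a + b = 1) (μ ν : ProbabilityMeasure ℝ) :
    moment V (mix a b hab μ ν) = a * moment V μ + b * moment V ν := by
  simp only [moment, mix, ProbabilityMeasure.coe_mk, lintegral_add_measure,
    lintegral_smul_measure, ENNReal.smul_def, smul_eq_mul]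

theorem mix_mem_momentBall {ν : ProbabilityMeasure ℝ} (hμ : μ ∈ momentBall V R)
    (hν : ν ∈ momentBall V R) {a b : ℝ≥0} (hab : a + b = 1) :
    mix a b hab μ ν ∈ momentBall V R := by
  change moment V _ ≤ _
  calc moment V (mix a b hab μ ν) = a * moment V μ + b * moment V ν := moment_mix V hab μ ν
    _ ≤ a * ENNReal.ofReal R + b * ENNReal.ofReal R := by gcongr <;> assumption
    _ = ENNReal.ofReal R := by rw [← add_mul, ← ENNReal.coe_add, hab, ENNReal.coe_one, one_mul]

theorem ofReal_mul_moment_mix_sub (hR : 0 ≤ R) (hα : α ≤ 0) {ν : ProbabilityMeasure ℝ}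
    (hμ : μ ∈ momentBall V R) (hν : ν ∈ momentBall V R) {a b : ℝ≥0} (hab : a + b = 1) :
    ENNReal.ofReal (α * ((moment V (mix a b hab μ ν)).toReal - R)) =
      a * ENNReal.ofReal (α * ((moment V μ).toReal - R)) +
        b * ENNReal.ofReal (α * ((moment V ν).toReal - R)) := by
  have hnonneg {ρ} (hρ : ρ ∈ momentBall V R) : 0 ≤ α * ((moment V ρ).toReal - R) :=
    mul_nonneg_of_nonpos_of_nonpos hα (sub_nonpos.2 (ENNReal.toReal_le_of_le_ofReal hR hρ))
  have hfin {ρ} (hρ : ρ ∈ momentBall V R) : moment V ρ ≠ ∞ := ne_top_of_le_ne_top (by simp) hρ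
  have hμ' := hfin hμ
  have hν' := hfin hν
  have hab' : (a : ℝ) + b = 1 := mod_cast hab
  rw [coe_mul_ofReal_add_coe_mul_ofReal a b (hnonneg hμ) (hnonneg hν), moment_mix,
    ENNReal.toReal_add (by finiteness) (by finiteness), ENNReal.toReal_mul, ENNReal.toReal_mul,
    ENNReal.coe_toReal, ENNReal.coe_toReal]
  congr 1
  linear_combination α * R * hab'

theorem IsOrlicz.strictlyConvex_rate (hV : IsOrlicz V) (hR : 0 ≤ R) (hα : α < 0) :
    StrictlyConvex (rate V R α) := by
  have := hV.isProbabilityMeasure_gibbs hα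
  intro μ ν hne hμ hν a b hab ha hb
  have hμR := mem_momentBall_of_rate_lt_top hμ
  have hνR := mem_momentBall_of_rate_lt_top hν
  rw [rate_of_mem_momentBall hμR] at hμ
  rw [rate_of_mem_momentBall hνR] at hν
  rw [rate_of_mem_momentBall (mix_mem_momentBall hμR hνR hab), rate_of_mem_momentBall hμR,
    rate_of_mem_momentBall hνR, ofReal_mul_moment_mix_sub hR hα.le hμR hνR, mul_add, mul_add,
    add_add_add_comm]
  have hne' : (μ : Measure ℝ) ≠ ν := fun h => hne (Subtype.ext h)
  exact ENNReal.add_lt_add_right (by finiteness) <| klDiv_add_smul_lt hne'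
    (ENNReal.add_lt_top.1 hμ).1.ne (ENNReal.add_lt_top.1 hν).1.ne hab ha hb

end Rate

section Empirical

variable {V : ℝ → ℝ} {R : ℝ}

theorem integral_empirical (f : ℝ → ℝ) (n : ℕ+) (x : Fin n → ℝ) :
    ∫ y, f y ∂(empirical n x : Measure ℝ) = (n : ℝ)⁻¹ * ∑ i, f (x i) := by
  rw [empirical, ProbabilityMeasure.coe_mk, integral_smul_measure,
    integral_finsetSum_measure fun i _ => integrable_dirac (by simp)]
  simp

theorem sum_eq_mul_integral_empirical (f : ℝ → ℝ) (n : ℕ+) (x : Fin n → ℝ) :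
    ∑ i, f (x i) = n * ∫ y, f y ∂(empirical n x : Measure ℝ) := by
  have hn : (n : ℝ) ≠ 0 := Nat.cast_ne_zero.2 n.ne_zero
  rw [integral_empirical, mul_inv_cancel_left₀ hn]

theorem continuous_empirical (n : ℕ+) : Continuous (empirical n) := by
  refine ProbabilityMeasure.continuous_iff_forall_continuous_integral.2 fun f => ?_
  simp_rw [integral_empirical]
  fun_prop

theorem IsOrlicz.empirical_mem_momentBall_iff (hV : IsOrlicz V) (hR : 0 ≤ R) (n : ℕ+)
    (x : Fin n → ℝ) : empirical n x ∈ momentBall V R ↔ x ∈ orliczBall V R n := by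
  have hn : (0 : ℝ) < n := Nat.cast_pos.2 n.pos
  change moment V (empirical n x) ≤ _ ↔ ∑ i, V (x i) ≤ _
  rw [ENNReal.le_ofReal_iff_toReal_le (moment_empirical_lt_top V n x).ne hR,
    ← hV.integral_eq_toReal_moment, integral_empirical, inv_mul_le_iff₀ hn, mul_comm R]

theorem IsOrlicz.isClosed_orliczBall (hV : IsOrlicz V) (n : ℕ) : IsClosed (orliczBall V R n) :=
  isClosed_le (continuous_finsetSum _ fun i _ => hV.continuous.comp (continuous_apply i))
    continuous_const

end Empirical

section ProductMeasure

theorem prod_ofReal_exp {ι : Type*} (t : Finset ι) (f : ι → ℝ) :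
    ∏ i ∈ t, ENNReal.ofReal (Real.exp (f i)) = ENNReal.ofReal (Real.exp (∑ i ∈ t, f i)) := by
  rw [Real.exp_sum, ENNReal.ofReal_prod_of_nonneg fun i _ => (Real.exp_pos _).le]

theorem ofReal_exp_div_ofReal_exp (a b : ℝ) : ENNReal.ofReal (Real.exp a) /
    ENNReal.ofReal (Real.exp b) = ENNReal.ofReal (Real.exp (a - b)) := by
  rw [← ENNReal.ofReal_div_of_pos (Real.exp_pos _), ← Real.exp_sub]

variable {X : Type*} [MeasurableSpace X] {ν : Measure X} [SigmaFinite ν] {n : ℕ}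

theorem lintegral_pi_prod {f : Fin n → X → ℝ≥0∞} (hf : ∀ i, Measurable (f i)) :
    ∫⁻ x, ∏ i, f i (x i) ∂(Measure.pi fun _ : Fin n => ν) = ∏ i, ∫⁻ x, f i x ∂ν := by
  induction n with
  | zero => simp [lintegral_unique]
  | succ n ih =>
    have hm : Measurable fun x : Fin n → X => ∏ i : Fin n, f i.succ (x i) :=
      Finset.measurable_fun_prod _ fun i _ => (hf _).comp (measurable_pi_apply i)
    have hmp := (measurePreserving_piFinSuccAbove (fun _ : Fin (n + 1) => ν) 0).symm
    rw [← hmp.lintegral_comp_emb (MeasurableEquiv.measurableEmbedding _), Fin.prod_univ_succ,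
      ← ih fun i => hf i.succ, ← lintegral_prod_mul (hf 0).aemeasurable hm.aemeasurable]
    simp [Fin.prod_univ_succ]

theorem pi_withDensity {p : X → ℝ≥0∞} (hp : Measurable p) [SigmaFinite (ν.withDensity p)] :
    Measure.pi (fun _ : Fin n => ν.withDensity p) =
      (Measure.pi fun _ => ν).withDensity fun x => ∏ i, p (x i) := by
  refine Measure.pi_eq fun s hs => ?_
  have hindicator : (univ.pi s).indicator (fun x => ∏ i, p (x i)) =
      fun x => ∏ i, (s i).indicator p (x i) := by
    ext x
    simp only [indicator, Fintype.prod_ite_zero]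
    congr! 1
    exact mem_univ_pi
  rw [withDensity_apply _ (MeasurableSet.univ_pi hs),
    ← lintegral_indicator (MeasurableSet.univ_pi hs), hindicator,
    lintegral_pi_prod fun i => hp.indicator (hs i)]
  simp_rw [withDensity_apply _ (hs _), ← lintegral_indicator (hs _)]

theorem pi_le_exp_mul_pi_of_sum_llr_le {μ : Measure X} [SigmaFinite μ] (hμν : μ ≪ ν)
    {E : Set (Fin n → X)} (hE : MeasurableSet E) {s : ℝ}
    (hs : ∀ x ∈ E, ∑ i, llr μ ν (x i) ≤ s) :
    Measure.pi (fun _ => μ) E ≤ ENNReal.ofReal (Real.exp s) * Measure.pi (fun _ => ν) E := by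
  set p : X → ℝ≥0∞ := fun x => ENNReal.ofReal (μ.rnDeriv ν x).toReal
  have hp : Measurable p := (Measure.measurable_rnDeriv μ ν).ennreal_toReal.ennreal_ofReal
  have hpμ : ν.withDensity p = μ := by
    rw [← Measure.withDensity_rnDeriv_eq μ ν hμν]
    refine withDensity_congr_ae ?_
    filter_upwards [Measure.rnDeriv_lt_top μ ν] with x hx
    exact ENNReal.ofReal_toReal hx.ne
  have : SigmaFinite (ν.withDensity p) := hpμ ▸ inferInstance
  have hpi : Measure.pi (fun _ : Fin n => μ) = Measure.pi fun _ => ν.withDensity p := by rw [hpμ]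
  rw [hpi, pi_withDensity hp, withDensity_apply _ hE, ← setLIntegral_const]
  refine setLIntegral_mono measurable_const fun x hx => ?_
  calc ∏ i, p (x i) ≤ ∏ i, ENNReal.ofReal (Real.exp (llr μ ν (x i))) :=
        Finset.prod_le_prod' fun i _ => ENNReal.ofReal_le_ofReal (Real.le_exp_log _)
    _ = ENNReal.ofReal (Real.exp (∑ i, llr μ ν (x i))) := prod_ofReal_exp _ _
    _ ≤ ENNReal.ofReal (Real.exp s) := ENNReal.ofReal_le_ofReal (Real.exp_le_exp.2 (hs x hx))

theorem pi_le_exp_of_le_sum [NeZero ν] {f : X → ℝ} (hf : Measurable f)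
    (hexp : Integrable (fun x => Real.exp (f x)) ν) {E : Set (Fin n → X)} {s : ℝ}
    (hs : ∀ x ∈ E, s ≤ ∑ i, f (x i)) :
    Measure.pi (fun _ => ν) E ≤
      ENNReal.ofReal (Real.exp (n * Real.log (∫ x, Real.exp (f x) ∂ν) - s)) := by
  have hfm : Measurable fun x => ENNReal.ofReal (Real.exp (f x)) := hf.exp.ennreal_ofReal
  have hm : Measurable fun x : Fin n → X => ∏ i, ENNReal.ofReal (Real.exp (f (x i))) :=
    Finset.measurable_fun_prod _ fun i _ => hfm.comp (measurable_pi_apply i)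
  have hint : ∫⁻ x, ∏ i, ENNReal.ofReal (Real.exp (f (x i))) ∂(Measure.pi fun _ : Fin n => ν) =
      ENNReal.ofReal (Real.exp (n * Real.log (∫ x, Real.exp (f x) ∂ν))) := by
    rw [lintegral_pi_prod fun _ => hfm, Finset.prod_const, Finset.card_univ, Fintype.card_fin,
      ← ofReal_integral_eq_lintegral_ofReal hexp (ae_of_all _ fun x => (Real.exp_pos _).le),
      ← ENNReal.ofReal_pow (integral_exp_pos hexp).le, Real.exp_nat_mul,
      Real.exp_log (integral_exp_pos hexp)]
  calc Measure.pi (fun _ => ν) E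
      ≤ Measure.pi (fun _ => ν)
          {x | ENNReal.ofReal (Real.exp s) ≤ ∏ i, ENNReal.ofReal (Real.exp (f (x i)))} :=
        measure_mono fun x hx => (ENNReal.ofReal_le_ofReal (Real.exp_le_exp.2 (hs x hx))).trans_eq
          (prod_ofReal_exp _ _).symm
    _ ≤ ENNReal.ofReal (Real.exp (n * Real.log (∫ x, Real.exp (f x) ∂ν))) /
          ENNReal.ofReal (Real.exp s) :=
        hint ▸ meas_ge_le_lintegral_div hm.aemeasurable (by simp [Real.exp_pos])
          ENNReal.ofReal_ne_top
    _ = _ := ofReal_exp_div_ofReal_exp _ _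

end ProductMeasure

section UpperBound

variable {V : ℝ → ℝ} {R γ c : ℝ} {μ : ProbabilityMeasure ℝ}

theorem norm_exp_le_exp_norm (g : ℝ →ᵇ ℝ) (x : ℝ) : ‖Real.exp (g x)‖ ≤ Real.exp ‖g‖ := by
  rw [Real.norm_eq_abs, Real.abs_exp]
  exact Real.exp_le_exp.2 ((le_abs_self _).trans (g.norm_coe_le_norm x))

theorem IsOrlicz.integrable_exp_mul_add (hV : IsOrlicz V) (hγ : γ < 0) (g : ℝ →ᵇ ℝ) :
    Integrable fun x => Real.exp (γ * V x + g x) := by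
  simp_rw [Real.exp_add]
  exact (hV.integrable_exp_mul hγ).mul_bdd g.continuous.rexp.aestronglyMeasurable
    (ae_of_all _ (norm_exp_le_exp_norm g))

theorem IsOrlicz.log_integral_exp_mul_add_le (hV : IsOrlicz V) (hγ : γ < 0) (g : ℝ →ᵇ ℝ) :
    Real.log (∫ x, Real.exp (γ * V x + g x)) ≤
      cgf V volume γ + ∫ x, (Real.exp (g x) - 1) ∂(gibbs V γ) := by
  have := hV.isProbabilityMeasure_gibbs hγ
  have hint := hV.integrable_exp_mul_add hγ g
  have hpos : 0 < ∫ x, Real.exp (γ * V x + g x) := integral_exp_pos hint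
  have hZ : 0 < mgf V volume γ := integral_exp_pos (hV.integrable_exp_mul hγ)
  have hratio : ∫ x, Real.exp (g x) ∂(gibbs V γ) =
      (∫ x, Real.exp (γ * V x + g x)) / mgf V volume γ := integral_exp_tilted _ _
  have hg : Integrable (fun x => Real.exp (g x)) (gibbs V γ) :=
    .of_bound g.continuous.rexp.aestronglyMeasurable _ (ae_of_all _ (norm_exp_le_exp_norm g))
  rw [integral_sub hg (integrable_const 1), hratio, integral_const, probReal_univ, one_smul, cgf,
    ← sub_le_iff_le_add', ← Real.log_div hpos.ne' hZ.ne']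
  exact Real.log_le_sub_one_of_pos (div_pos hpos hZ)

/-- The test function is `γ V + g`, where `g` is a Donsker–Varadhan test function for the
divergence from `gibbs V γ`; the sum of `γ V` over a point of the ball is at least `γ R n`. -/
theorem IsOrlicz.exists_nhds_volume_le_of_lt_klDiv (hV : IsOrlicz V) (hγ : γ < 0)
    (h : ((c + cgf V volume γ - γ * R : ℝ) : EReal) < klDiv (μ : Measure ℝ) (gibbs V γ)) :
    ∃ U ∈ 𝓝 μ, ∀ n : ℕ+, volume (orliczBall V R n ∩ {x | empirical n x ∈ U}) ≤
      ENNReal.ofReal (Real.exp (-(n * c))) := by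
  have := hV.isProbabilityMeasure_gibbs hγ
  obtain ⟨g, hg⟩ := exists_boundedContinuous_lt_dvFunctional h
  have hlog := hV.log_integral_exp_mul_add_le hγ g
  set t := c + cgf V volume γ - γ * R + ∫ x, (Real.exp (g x) - 1) ∂(gibbs V γ)
  set U : Set (ProbabilityMeasure ℝ) := {ρ | t < ∫ x, g x ∂(ρ : Measure ℝ)}
  have hU : IsOpen U := isOpen_Ioi.preimage
    (ProbabilityMeasure.continuous_integral_boundedContinuousFunction g)
  refine ⟨U, hU.mem_nhds (lt_sub_iff_add_lt.1 hg), fun n => ?_⟩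
  have hsum : ∀ x ∈ orliczBall V R n ∩ {x | empirical n x ∈ U},
      n * (t + γ * R) ≤ ∑ i, (γ * V (x i) + g (x i)) := by
    rintro x ⟨hx, hxt⟩
    have hgx : n * t ≤ ∑ i, g (x i) := by
      rw [sum_eq_mul_integral_empirical]
      exact mul_le_mul_of_nonneg_left (le_of_lt hxt) n.1.cast_nonneg
    have hVx : γ * (R * n) ≤ γ * ∑ i, V (x i) := mul_le_mul_of_nonpos_left hx hγ.le
    rw [Finset.sum_add_distrib, ← Finset.mul_sum]
    linarith
  have hm : Measurable fun x => γ * V x + g x :=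
    ((hV.continuous.const_mul γ).add g.continuous).measurable
  refine (pi_le_exp_of_le_sum hm (hV.integrable_exp_mul_add hγ g) hsum).trans
    (ENNReal.ofReal_le_ofReal (Real.exp_le_exp.2 ?_))
  have := mul_le_mul_of_nonneg_left hlog (n : ℕ).cast_nonneg (α := ℝ)
  linarith

/-- As `γ → 0⁻` the bound for `gibbs V γ` turns into one for Lebesgue measure. -/
theorem IsOrlicz.exists_nhds_volume_le (hV : IsOrlicz V) (hR : 0 ≤ R) (hμ : μ ∈ momentBall V R)
    (h : (c : EReal) < negEntropy (μ : Measure ℝ) volume) :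
    ∃ U ∈ 𝓝 μ, ∀ n : ℕ+, volume (orliczBall V R n ∩ {x | empirical n x ∈ U}) ≤
      ENNReal.ofReal (Real.exp (-(n * c))) := by
  obtain ⟨e, hce, he⟩ := EReal.lt_iff_exists_real_btwn.1 h
  have hce : 0 < e - c := sub_pos.2 (mod_cast hce)
  have hVμ := integrable_of_mem_momentBall hV.continuous hV.nonneg hμ
  set m := ∫ x, V x ∂(μ : Measure ℝ)
  have hm : 0 ≤ R - m :=
    sub_nonneg.2 (integral_le_of_mem_momentBall hV.continuous hV.nonneg hR hμ)
  set γ := -((e - c) / (R - m + 1))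
  have hγ : γ < 0 := neg_lt_zero.2 (by positivity)
  have hγm : c - γ * (R - m) ≤ e := by
    have : (e - c) / (R - m + 1) * (R - m + 1) = e - c := div_mul_cancel₀ _ (by positivity)
    nlinarith
  refine hV.exists_nhds_volume_le_of_lt_klDiv hγ ?_
  rw [hV.coe_klDiv_gibbs hγ hVμ]
  calc ((c + cgf V volume γ - γ * R : ℝ) : EReal)
      ≤ ((e + (cgf V volume γ - γ * m) : ℝ) : EReal) := EReal.coe_le_coe_iff.2 (by linarith)
    _ = (e : EReal) + ((cgf V volume γ - γ * m : ℝ) : EReal) := EReal.coe_add _ _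
    _ < _ := EReal.add_lt_add_right_coe he _

end UpperBound

section LawOfLargeNumbers

variable {X : Type*} [MeasurableSpace X] (μ : Measure X) [IsProbabilityMeasure μ]

theorem ae_tendsto_average {f : X → ℝ} (hf : Measurable f) (hfi : Integrable f μ) :
    ∀ᵐ ω ∂(Measure.infinitePi fun _ : ℕ => μ),
      Tendsto (fun n : ℕ+ => (n : ℝ)⁻¹ * ∑ i : Fin n, f (ω i)) atTop (𝓝 (∫ x, f x ∂μ)) := by
  set Λ := Measure.infinitePi fun _ : ℕ => μ
  have heval (i : ℕ) : MeasurePreserving (fun ω : ℕ → X => ω i) Λ μ :=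
    measurePreserving_eval_infinitePi _ i
  have hident (i : ℕ) : IdentDistrib (fun ω : ℕ → X => ω i) (fun ω => ω 0) Λ Λ :=
    ⟨(heval i).aemeasurable, (heval 0).aemeasurable, (heval i).map_eq.trans (heval 0).map_eq.symm⟩
  have hindep : iIndepFun (fun (i : ℕ) (ω : ℕ → X) => f (ω i)) Λ :=
    iIndepFun_infinitePi fun _ => hf
  have hmean : ∫ ω, f (ω 0) ∂Λ = ∫ x, f x ∂μ := by
    rw [← integral_map (heval 0).aemeasurable hf.aestronglyMeasurable, (heval 0).map_eq]
  filter_upwards [strong_law_ae_real _ ((heval 0).integrable_comp_of_integrable hfi)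
    (fun _ _ hij => hindep.indepFun hij) fun i => (hident i).comp hf] with ω hω
  rw [← hmean]
  refine (hω.comp tendsto_PNat_val_atTop_atTop).congr fun n => ?_
  simp only [Function.comp_apply, Finset.sum_range, div_eq_inv_mul]

theorem tendsto_pi_of_ae_eventually_mem {E : ∀ n : ℕ+, Set (Fin n → X)}
    (hE : ∀ n, MeasurableSet (E n))
    (h : ∀ᵐ ω ∂(Measure.infinitePi fun _ : ℕ => μ),
      ∀ᶠ n : ℕ+ in atTop, (fun i : Fin n => ω i) ∈ E n) :
    Tendsto (fun n : ℕ+ => Measure.pi (fun _ : Fin n => μ) (E n)) atTop (𝓝 1) := by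
  set Λ := Measure.infinitePi fun _ : ℕ => μ
  have hrestrict (n : ℕ+) : Measurable fun (ω : ℕ → X) (i : Fin n) => ω i :=
    measurable_pi_lambda _ fun i => measurable_pi_apply _
  have hpi (n : ℕ+) : Λ {ω | (fun i : Fin n => ω i) ∈ E n} = Measure.pi (fun _ => μ) (E n) := by
    have hmap : Λ.map (fun ω (i : Fin n) => ω i) = Measure.pi fun _ => μ := by
      rw [Measure.map_infinitePi_infinitePi_of_inj (f := fun i : Fin n => (i : ℕ))
        Fin.val_injective, Measure.infinitePi_eq_pi]
    rw [← hmap, Measure.map_apply (hrestrict n) (hE n)]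
    rfl
  simp_rw [← hpi, ← measure_univ (μ := Λ)]
  refine tendsto_measure_of_ae_tendsto_indicator_of_isFiniteMeasure _ .univ
    (fun n => hrestrict n (hE n)) ?_
  filter_upwards [h] with ω hω
  filter_upwards [hω] with n hn
  exact iff_of_true hn (mem_univ ω)

theorem ae_eventually_empirical_mem {μ : ProbabilityMeasure ℝ} {U : Set (ProbabilityMeasure ℝ)}
    (hU : U ∈ 𝓝 μ) : ∀ᵐ ω ∂(Measure.infinitePi fun _ : ℕ => (μ : Measure ℝ)),
      ∀ᶠ n : ℕ+ in atTop, (empirical n fun i => ω i) ∈ U := by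
  have hlim : Tendsto (fun p : (ℕ → ℝ) × ℕ+ => empirical p.2 fun i => p.1 i)
      ((ae (Measure.infinitePi fun _ : ℕ => (μ : Measure ℝ))).curry atTop) (𝓝 μ) := by
    refine ProbabilityMeasure.tendsto_iff_forall_integral_tendsto.2 fun f => ?_
    simp_rw [integral_empirical]
    have hf := ae_tendsto_average (μ : Measure ℝ) f.continuous.measurable (f.integrable _)
    exact Tendsto.curry (f := fun (ω : ℕ → ℝ) (n : ℕ+) => (n : ℝ)⁻¹ * ∑ i : Fin n, f (ω i)) hf
  exact eventually_curry_iff.1 (hlim.eventually_mem hU)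

end LawOfLargeNumbers

section LowerBound

variable {V : ℝ → ℝ} {R α c : ℝ} {μ : ProbabilityMeasure ℝ} {U : Set (ProbabilityMeasure ℝ)}

theorem tendsto_natCast_pnat_atTop : Tendsto (fun n : ℕ+ => (n : ℝ)) atTop atTop :=
  tendsto_natCast_atTop_atTop.comp tendsto_PNat_val_atTop_atTop

theorem tendsto_ofReal_exp_neg_mul (hc : 0 < c) :
    Tendsto (fun n : ℕ+ => ENNReal.ofReal (Real.exp (-(n * c)))) atTop (𝓝 0) := by
  rw [← ENNReal.ofReal_zero]
  exact ENNReal.tendsto_ofReal (Real.tendsto_exp_neg_atTop_nhds_zero.comp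
    (tendsto_natCast_pnat_atTop.atTop_mul_const hc))

theorem IsOrlicz.eventually_le_volume_of_integral_lt (hV : IsOrlicz V)
    (hVμ : Integrable V (μ : Measure ℝ)) (hVR : ∫ x, V x ∂(μ : Measure ℝ) < R)
    (hc : negEntropy (μ : Measure ℝ) volume < c) (hU : IsOpen U) (hμU : μ ∈ U) :
    ∀ᶠ n : ℕ+ in atTop, ENNReal.ofReal (Real.exp (-(n * c))) ≤
      volume (orliczBall V R n ∩ {x | empirical n x ∈ U}) := by
  have hfin := hc.trans (EReal.coe_lt_top c)
  obtain ⟨hac, hllr⟩ := negEntropy_lt_top_iff.1 hfin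
  rw [negEntropy_of_lt_top hfin, EReal.coe_lt_coe_iff] at hc
  obtain ⟨d, hd, hdc⟩ := exists_between hc
  set E : ∀ n : ℕ+, Set (Fin n → ℝ) := fun n => (orliczBall V R n ∩ {x | empirical n x ∈ U}) ∩
    {x | ∑ i, llr (μ : Measure ℝ) volume (x i) ≤ n * d}
  have hE (n : ℕ+) : MeasurableSet (E n) :=
    ((hV.isClosed_orliczBall n).measurableSet.inter
      (hU.preimage (continuous_empirical n)).measurableSet).inter <|
      measurableSet_le (Finset.measurable_fun_sum _ fun i _ =>
        (measurable_llr _ _).comp (measurable_pi_apply i)) measurable_const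
  have hEμ := tendsto_pi_of_ae_eventually_mem (μ : Measure ℝ) hE <| by
    filter_upwards [ae_tendsto_average (μ : Measure ℝ) hV.continuous.measurable hVμ,
      ae_tendsto_average (μ : Measure ℝ) (measurable_llr _ _) hllr,
      ae_eventually_empirical_mem (hU.mem_nhds hμU)] with ω hωV hωllr hωU
    filter_upwards [hωV.eventually_le_const hVR, hωllr.eventually_le_const hd, hωU]
      with n hnV hnllr hnU
    have hn : (0 : ℝ) < n := Nat.cast_pos.2 n.pos
    rw [inv_mul_le_iff₀ hn] at hnV hnllr
    exact ⟨⟨hnV.trans_eq (mul_comm _ _), hnU⟩, hnllr⟩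
  filter_upwards [(tendsto_ofReal_exp_neg_mul (sub_pos.2 hdc)).eventually_lt hEμ zero_lt_one]
    with n hn
  calc ENNReal.ofReal (Real.exp (-(n * c)))
      = ENNReal.ofReal (Real.exp (-(n * d))) * ENNReal.ofReal (Real.exp (-(n * (c - d)))) := by
        rw [← ENNReal.ofReal_mul (Real.exp_pos _).le, ← Real.exp_add]
        ring_nf
    _ ≤ ENNReal.ofReal (Real.exp (-(n * d))) *
          (ENNReal.ofReal (Real.exp (n * d)) * volume (E n)) := by
        gcongr
        exact hn.le.trans (pi_le_exp_mul_pi_of_sum_llr_le hac (hE n) fun x hx => hx.2)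
    _ = volume (E n) := by
        rw [← mul_assoc, ← ENNReal.ofReal_mul (Real.exp_pos _).le, ← Real.exp_add, neg_add_cancel,
          Real.exp_zero, ENNReal.ofReal_one, one_mul]
    _ ≤ _ := measure_mono inter_subset_left

theorem tendsto_mix {ι : Type*} {l : Filter ι} {a b : ι → ℝ≥0} (hab : ∀ i, a i + b i = 1)
    (ha : Tendsto a l (𝓝 1)) (hb : Tendsto b l (𝓝 0)) (μ ν : ProbabilityMeasure ℝ) :
    Tendsto (fun i => mix (a i) (b i) (hab i) μ ν) l (𝓝 μ) := by
  refine ProbabilityMeasure.tendsto_iff_forall_integral_tendsto.2 fun f => ?_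
  have hf (i : ι) : ∫ x, f x ∂(mix (a i) (b i) (hab i) μ ν : Measure ℝ) =
      a i * ∫ x, f x ∂(μ : Measure ℝ) + b i * ∫ x, f x ∂(ν : Measure ℝ) := by
    simp only [mix, ProbabilityMeasure.coe_mk]
    rw [integral_add_measure (f.integrable _) (f.integrable _), integral_smul_nnreal_measure,
      integral_smul_nnreal_measure]
    rfl
  simp_rw [hf]
  simpa using ((NNReal.tendsto_coe.2 ha).mul_const (∫ x, f x ∂(μ : Measure ℝ))).add
    ((NNReal.tendsto_coe.2 hb).mul_const (∫ x, f x ∂(ν : Measure ℝ)))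

theorem moment_mix_lt {ν : ProbabilityMeasure ℝ} (hμ : μ ∈ momentBall V R)
    (hν : moment V ν < ENNReal.ofReal R) {a b : ℝ≥0} (hab : a + b = 1) (hb : 0 < b) :
    moment V (mix a b hab μ ν) < ENNReal.ofReal R := by
  calc moment V (mix a b hab μ ν) = a * moment V μ + b * moment V ν := moment_mix V hab μ ν
    _ ≤ a * ENNReal.ofReal R + b * moment V ν := by gcongr; exact hμ
    _ < a * ENNReal.ofReal R + b * ENNReal.ofReal R := by
        refine ENNReal.add_lt_add_left (by finiteness) ?_
        exact ENNReal.mul_lt_mul_right (by simpa using hb.ne') (by finiteness) hν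
    _ = ENNReal.ofReal R := by rw [← add_mul, ← ENNReal.coe_add, hab, ENNReal.coe_one, one_mul]

theorem IsOrlicz.exists_moment_lt (hV : IsOrlicz V) (hR : 0 < R) (hα : α < 0) :
    ∃ ρ, moment V ρ < ENNReal.ofReal R ∧ rate V R α ρ < ∞ := by
  obtain ⟨β, hβ, hβR⟩ := hV.exists_deriv_cgf_eq (half_pos hR)
  have hm : moment V (hV.gibbsPM hβ) = ENNReal.ofReal (R / 2) := by rw [hV.moment_gibbsPM, hβR]
  have hlt : moment V (hV.gibbsPM hβ) < ENNReal.ofReal R :=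
    hm ▸ (ENNReal.ofReal_lt_ofReal_iff hR).2 (half_lt_self hR)
  refine ⟨hV.gibbsPM hβ, hlt, ?_⟩
  have hH := hV.coe_rate (half_pos hR).le hβ hm.le
  rw [hV.rate_gibbsPM (half_pos hR).le hβ hβR] at hH
  rw [← EReal.coe_ennreal_lt_coe_ennreal_iff, hV.coe_rate hR.le hα hlt.le]
  generalize negEntropy (hV.gibbsPM hβ : Measure ℝ) volume = H at hH ⊢
  induction H with
  | bot => exact bot_lt_top
  | coe x => exact_mod_cast EReal.coe_lt_top _
  | top => simp only [EReal.top_add_coe, EReal.coe_ennreal_zero, EReal.zero_ne_top] at hH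

theorem IsOrlicz.exists_mem_moment_lt_rate_lt (hV : IsOrlicz V) (hR : 0 < R) (hα : α < 0)
    {c : ℝ≥0∞} (hc : rate V R α μ < c) (hU : IsOpen U) (hμU : μ ∈ U) :
    ∃ ρ ∈ U, moment V ρ < ENNReal.ofReal R ∧ rate V R α ρ < c := by
  obtain ⟨ν, hνR, hν⟩ := hV.exists_moment_lt hR hα
  obtain rfl | hne := eq_or_ne μ ν
  · exact ⟨μ, hμU, hνR, hc⟩
  have hμ : rate V R α μ < ∞ := hc.trans_le le_top
  have hb : Tendsto (fun k : ℕ => ((k + 2 : ℕ) : ℝ≥0)⁻¹) atTop (𝓝 0) :=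
    (tendsto_add_atTop_iff_nat 2).2 tendsto_inv_atTop_nhds_zero_nat
  set b : ℕ → ℝ≥0 := fun k => ((k + 2 : ℕ) : ℝ≥0)⁻¹
  have hb0 (k : ℕ) : 0 < b k := by positivity
  have hb1 (k : ℕ) : b k < 1 := inv_lt_one_of_one_lt₀ (by norm_cast; lia)
  have ha : Tendsto (fun k => 1 - b k) atTop (𝓝 1) := by simpa using hb.const_sub 1
  have hab (k : ℕ) : (1 - b k) + b k = 1 := tsub_add_cancel_of_le (hb1 k).le
  have hrate : Tendsto (fun k => ((1 - b k : ℝ≥0) : ℝ≥0∞) * rate V R α μ + b k * rate V R α ν) atTop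
      (𝓝 (rate V R α μ)) := by
    simpa using (ENNReal.Tendsto.mul_const (ENNReal.tendsto_coe.2 ha) (.inr hμ.ne)).add
      (ENNReal.Tendsto.mul_const (ENNReal.tendsto_coe.2 hb) (.inr hν.ne))
  obtain ⟨k, hkU, hkc⟩ := (((tendsto_mix hab ha hb μ ν).eventually (hU.mem_nhds hμU)).and
    (hrate.eventually_lt_const hc)).exists
  exact ⟨_, hkU, moment_mix_lt (mem_momentBall_of_rate_lt_top hμ) hνR (hab k) (hb0 k),
    (hV.strictlyConvex_rate hR.le hα μ ν hne hμ hν _ _ (hab k) (tsub_pos_of_lt (hb1 k))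
      (hb0 k)).trans hkc⟩

theorem IsOrlicz.eventually_le_volume (hV : IsOrlicz V) (hR : 0 < R) (hα : α < 0)
    (hc : (rate V R α μ : EReal) < c) (hU : IsOpen U) (hμU : μ ∈ U) :
    ∀ᶠ n : ℕ+ in atTop,
      ENNReal.ofReal (Real.exp (-(n * (c - (cgf V volume α - α * R))))) ≤
        volume (orliczBall V R n ∩ {x | empirical n x ∈ U}) := by
  have hc' : ((ENNReal.ofReal c : ℝ≥0∞) : EReal) = c := by
    rw [EReal.coe_ennreal_ofReal,
      max_eq_left (EReal.coe_nonneg.1 ((EReal.coe_ennreal_nonneg _).trans hc.le))]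
  rw [← hc', EReal.coe_ennreal_lt_coe_ennreal_iff] at hc
  obtain ⟨ρ, hρU, hρR, hρ⟩ := hV.exists_mem_moment_lt_rate_lt hR hα hc hU hμU
  have hVρ := integrable_of_mem_momentBall hV.continuous hV.nonneg hρR.le
  have hint : ∫ x, V x ∂(ρ : Measure ℝ) < R := by
    rw [hV.integral_eq_toReal_moment]
    exact ENNReal.toReal_lt_of_lt_ofReal hρR
  refine hV.eventually_le_volume_of_integral_lt hVρ hint ?_ hU hρU
  rw [← EReal.coe_ennreal_lt_coe_ennreal_iff, hc', hV.coe_rate hR.le hα hρR.le] at hρ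
  rw [EReal.coe_sub]
  exact EReal.lt_sub_iff_add_lt (.inl (EReal.coe_ne_bot _)) (.inl (EReal.coe_ne_top _)) |>.2 hρ

end LowerBound

section LogScale

theorem logScale_strictMono (n : ℕ+) : StrictMono (logScale n) := by
  have h (p : ℝ≥0∞) : logScale n p = ENNReal.log p / ((n : ℝ) : EReal) := by
    rw [logScale, EReal.div_eq_inv_mul, one_div, EReal.coe_inv]
  have hn : (0 : EReal) < ((n : ℝ) : EReal) := EReal.coe_pos.2 (Nat.cast_pos.2 n.pos)
  intro p q hpq
  rw [h, h]
  exact EReal.strictMono_div_right_of_pos hn (EReal.coe_ne_top _) (ENNReal.log_strictMono hpq)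

theorem logScale_exp (n : ℕ+) (c : ℝ) :
    logScale n (ENNReal.ofReal (Real.exp (-(n * c)))) = ((-c : ℝ) : EReal) := by
  have hn : ((n : ℕ) : ℝ) ≠ 0 := Nat.cast_ne_zero.2 n.ne_zero
  rw [logScale, ENNReal.log_ofReal_of_pos (Real.exp_pos _), Real.log_exp, ← EReal.coe_mul]
  congr 1
  field_simp

theorem logScale_le_iff {n : ℕ+} {p : ℝ≥0∞} {c : ℝ} :
    logScale n p ≤ ((-c : ℝ) : EReal) ↔ p ≤ ENNReal.ofReal (Real.exp (-(n * c))) := by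
  rw [← logScale_exp n, (logScale_strictMono n).le_iff_le]

theorem le_logScale_iff {n : ℕ+} {p : ℝ≥0∞} {c : ℝ} :
    ((-c : ℝ) : EReal) ≤ logScale n p ↔ ENNReal.ofReal (Real.exp (-(n * c))) ≤ p := by
  rw [← logScale_exp n, (logScale_strictMono n).le_iff_le]

theorem eventually_natCast_mul_exp_le (N : ℕ) {c d : ℝ} (h : c < d) :
    ∀ᶠ n : ℕ+ in atTop, N * ENNReal.ofReal (Real.exp (-(n * d))) ≤
      ENNReal.ofReal (Real.exp (-(n * c))) := by
  have ht := Real.tendsto_exp_atTop.comp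
    (tendsto_natCast_pnat_atTop.atTop_mul_const (sub_pos.2 h))
  filter_upwards [ht.eventually_ge_atTop (N : ℝ)] with n hn
  rw [← ENNReal.ofReal_natCast, ← ENNReal.ofReal_mul N.cast_nonneg]
  refine ENNReal.ofReal_le_ofReal ?_
  calc (N : ℝ) * Real.exp (-(n * d))
      ≤ Real.exp (n * (d - c)) * Real.exp (-(n * d)) := by gcongr; exact hn
    _ = Real.exp (-(n * c)) := by rw [← Real.exp_add]; ring_nf

end LogScale

section LocalBounds

variable {X Y : Type*} [TopologicalSpace X] [TopologicalSpace Y] {Ω : ℕ+ → Type*}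
  [∀ n, MeasurableSpace (Ω n)] {P : ∀ n, Measure (Ω n)} {ξ : ∀ n, Ω n → X} {I : X → ℝ≥0∞}
  {K : Set X}

/-- Local large deviation bounds with speed `n` and rate function `I`, for random variables with
values in a compact set `K`: they imply the large deviation principle by a covering argument, see
`HasLocalBounds.satisfiesLDP`. The bounds are stated without logarithms, and `I` takes the value
`∞` off `K`. -/
structure HasLocalBounds (P : ∀ n, Measure (Ω n)) (ξ : ∀ n, Ω n → X) (I : X → ℝ≥0∞)
    (K : Set X) : Prop where
  isCompact : IsCompact K
  ae_mem : ∀ n, ∀ᵐ ω ∂P n, ξ n ω ∈ K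
  mem_of_lt_top : ∀ x, I x < ∞ → x ∈ K
  exists_nhds_le : ∀ x ∈ K, ∀ c : ℝ, (c : EReal) < I x → ∃ U ∈ 𝓝 x, ∀ᶠ n : ℕ+ in atTop,
    P n {ω | ξ n ω ∈ U} ≤ ENNReal.ofReal (Real.exp (-(n * c)))
  eventually_le : ∀ x, ∀ c : ℝ, (I x : EReal) < c → ∀ U, IsOpen U → x ∈ U → ∀ᶠ n : ℕ+ in atTop,
    ENNReal.ofReal (Real.exp (-(n * c))) ≤ P n {ω | ξ n ω ∈ U}

namespace HasLocalBounds

theorem le_of_eventually_le (h : HasLocalBounds P ξ I K) {U : Set X} {c : ℝ}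
    (hU : ∀ᶠ n : ℕ+ in atTop, P n {ω | ξ n ω ∈ U} ≤ ENNReal.ofReal (Real.exp (-(n * c)))) {x : X}
    (hx : x ∈ interior U) : (c : EReal) ≤ I x := by
  by_contra! hlt
  obtain ⟨d, hxd, hdc⟩ := EReal.lt_iff_exists_real_btwn.1 hlt
  obtain ⟨n, hle, hge⟩ := (hU.and (h.eventually_le x d hxd _ isOpen_interior hx)).exists
  have hexp := (hge.trans (measure_mono fun _ hω => interior_subset (s := U) hω)).trans hle
  rw [← logScale_le_iff, logScale_exp, EReal.coe_le_coe_iff, neg_le_neg_iff] at hexp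
  exact hexp.not_gt (EReal.coe_lt_coe_iff.1 hdc)

theorem lowerSemicontinuous [T2Space X] (h : HasLocalBounds P ξ I K) : LowerSemicontinuous I := by
  intro x y hy
  by_cases hx : x ∈ K
  · obtain ⟨c, hyc, hcx⟩ := ENNReal.lt_iff_exists_nnreal_btwn.1 hy
    obtain ⟨U, hU, hUc⟩ := h.exists_nhds_le x hx c (EReal.coe_ennreal_lt_coe_ennreal_iff.2 hcx)
    filter_upwards [interior_mem_nhds.2 hU] with z hz
    exact hyc.trans_le (EReal.coe_ennreal_le_coe_ennreal_iff.1 (h.le_of_eventually_le hUc hz))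
  · filter_upwards [h.isCompact.isClosed.isOpen_compl.mem_nhds hx] with z hz
    exact hy.trans_le (le_top.trans (not_lt.1 fun hlt => hz (h.mem_of_lt_top z hlt)))

theorem isGoodRate [T2Space X] (h : HasLocalBounds P ξ I K) : IsGoodRate I := fun _ =>
  h.isCompact.of_isClosed_subset (h.lowerSemicontinuous.isClosed_preimage _) fun x hx =>
    h.mem_of_lt_top x (lt_of_le_of_lt hx ENNReal.coe_lt_top)

theorem eventually_measure_le (h : HasLocalBounds P ξ I K) {F : Set X} (hF : IsClosed F)
    {c d : ℝ} (hc : ∀ x ∈ F, (c : EReal) < I x) (hd : d < c) :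
    ∀ᶠ n : ℕ+ in atTop, P n {ω | ξ n ω ∈ F} ≤ ENNReal.ofReal (Real.exp (-(n * d))) := by
  choose! U hU hUc using fun x (hx : x ∈ F ∩ K) => h.exists_nhds_le x hx.2 c (hc x hx.1)
  obtain ⟨t, ht, hcover⟩ := (h.isCompact.inter_left hF).elim_nhds_subcover U hU
  filter_upwards [(Finset.eventually_all t).2 fun x hx => hUc x (ht x hx),
    eventually_natCast_mul_exp_le t.card hd] with n hn hcard
  have hsub : {ω | ξ n ω ∈ F} ≤ᵐ[P n] ⋃ x ∈ t, {ω | ξ n ω ∈ U x} := by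
    filter_upwards [h.ae_mem n] with ω hω hωF
    obtain ⟨x, hx, hωx⟩ := mem_iUnion₂.1 (hcover ⟨hωF, hω⟩)
    exact mem_iUnion₂.2 ⟨x, hx, hωx⟩
  calc P n {ω | ξ n ω ∈ F}
      ≤ P n (⋃ x ∈ t, {ω | ξ n ω ∈ U x}) := measure_mono_ae hsub
    _ ≤ ∑ x ∈ t, P n {ω | ξ n ω ∈ U x} := measure_biUnion_finset_le _ _
    _ ≤ t.card * ENNReal.ofReal (Real.exp (-(n * c))) := by
        rw [← nsmul_eq_mul]
        exact Finset.sum_le_card_nsmul _ _ _ hn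
    _ ≤ ENNReal.ofReal (Real.exp (-(n * d))) := hcard

theorem neg_iInf_le_liminf (h : HasLocalBounds P ξ I K) {U : Set X} (hU : IsOpen U) :
    -(⨅ x ∈ U, (I x : EReal)) ≤ liminf (fun n => logScale n (P n {ω | ξ n ω ∈ U})) atTop := by
  rw [EReal.neg_le]
  refine le_iInf₂ fun x hx => EReal.neg_le.1 (le_of_forall_lt fun a ha => ?_)
  obtain ⟨c, hac, hcx⟩ := EReal.lt_iff_exists_real_btwn.1 ha
  refine hac.trans_le (le_liminf_of_le (by isBoundedDefault) ?_)
  filter_upwards [h.eventually_le x (-c) (EReal.lt_neg_comm.1 hcx) U hU hx] with n hn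
  simpa only [neg_neg] using le_logScale_iff.2 hn

theorem limsup_le_neg_iInf (h : HasLocalBounds P ξ I K) {F : Set X} (hF : IsClosed F) :
    limsup (fun n => logScale n (P n {ω | ξ n ω ∈ F})) atTop ≤ -(⨅ x ∈ F, (I x : EReal)) := by
  refine le_of_forall_gt_imp_ge_of_dense fun a ha => ?_
  obtain ⟨c, hc, hca⟩ := EReal.lt_iff_exists_real_btwn.1 ha
  obtain ⟨d, hcd, hda⟩ := EReal.lt_iff_exists_real_btwn.1 hca
  have hcF (x : X) (hx : x ∈ F) : ((-c : ℝ) : EReal) < I x :=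
    (EReal.neg_lt_comm.1 hc).trans_le (iInf₂_le x hx)
  refine (limsup_le_of_le (by isBoundedDefault) ?_).trans hda.le
  filter_upwards [h.eventually_measure_le hF hcF (neg_lt_neg (EReal.coe_lt_coe_iff.1 hcd))]
    with n hn
  simpa only [neg_neg] using logScale_le_iff.2 hn

theorem satisfiesLDP [T2Space X] (h : HasLocalBounds P ξ I K) : SatisfiesLDP P ξ I where
  good := h.isGoodRate
  lower _ _ := h.neg_iInf_le_liminf isOpen_interior
  middle _ _ := (liminf_le_limsup).trans <| limsup_le_limsup <| .of_forall fun n =>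
    (logScale_strictMono n).monotone (measure_mono fun _ hω => interior_subset_closure hω)
  upper _ _ := h.limsup_le_neg_iInf isClosed_closure

/-- An inverse contraction principle: over `K`, the topology of `Y` is no finer than the one
pulled back along `φ`. -/
theorem of_comp {φ : Y → X} {η : ∀ n, Ω n → Y} (h : HasLocalBounds P (fun n ω => φ (η n ω)) I K)
    (hφ : Continuous φ) (hK : K ⊆ range φ)
    (hcomap : ∀ y, φ y ∈ K → comap φ (𝓝[K] (φ y)) ≤ 𝓝 y) :
    HasLocalBounds P η (fun y => I (φ y)) (φ ⁻¹' K) where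
  isCompact := by
    refine isCompact_iff_ultrafilter_le_nhds.2 fun f hf => ?_
    have hfK : map φ f ≤ 𝓟 K := tendsto_principal.2 (le_principal_iff.1 hf)
    obtain ⟨x, hx, hfx⟩ := isCompact_iff_ultrafilter_le_nhds.1 h.isCompact (f.map φ) hfK
    obtain ⟨y, rfl⟩ := hK hx
    exact ⟨y, hx, (map_le_iff_le_comap.1 (le_inf hfx hfK)).trans (hcomap y hx)⟩
  ae_mem := h.ae_mem
  mem_of_lt_top y := h.mem_of_lt_top (φ y)
  exists_nhds_le y hy c hc := by
    obtain ⟨U, hU, hUc⟩ := h.exists_nhds_le (φ y) hy c hc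
    exact ⟨φ ⁻¹' U, hφ.continuousAt.preimage_mem_nhds hU, hUc⟩
  eventually_le y c hc U hU hyU := by
    have hy : φ y ∈ K := h.mem_of_lt_top _ <|
      EReal.coe_ennreal_lt_coe_ennreal_iff.1 (hc.trans_le le_top)
    obtain ⟨t, ht, htU⟩ := hcomap y hy (hU.mem_nhds hyU)
    obtain ⟨O, hO, hyO, hOt⟩ := mem_nhdsWithin.1 ht
    filter_upwards [h.eventually_le (φ y) c hc O hO hyO] with n hn
    refine hn.trans (measure_mono_ae ?_)
    filter_upwards [h.ae_mem n] with ω hω hωO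
    exact htU (hOt ⟨hωO, hω⟩)

end HasLocalBounds

theorem SatisfiesLDP.eq_zero_of_eq_zero [T2Space X] [RegularSpace X] {J : X → ℝ≥0∞}
    (hI : SatisfiesLDP P ξ I) (hJ : SatisfiesLDP P ξ J) {x : X} (hx : I x = 0) : J x = 0 := by
  by_contra hne
  obtain ⟨c, hc0, hc⟩ := ENNReal.lt_iff_exists_nnreal_btwn.1 (pos_iff_ne_zero.2 hne)
  obtain ⟨C, hC, hCc, hCJ⟩ := exists_mem_nhds_isClosed_subset
    ((hJ.good c).isClosed.isOpen_compl.mem_nhds (not_le.2 hc : x ∈ {y | J y ≤ c}ᶜ))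
  have hCm : MeasurableSet[borel X] C := by
    borelize X
    exact hCc.measurableSet
  have hcJ : ((c : ℝ≥0∞) : EReal) ≤ ⨅ y ∈ closure C, (J y : EReal) := by
    refine le_iInf₂ fun y hy => EReal.coe_ennreal_le_coe_ennreal_iff.2 ?_
    exact (not_le.1 (hCJ (hCc.closure_eq ▸ hy))).le
  have hI0 : (⨅ y ∈ interior C, (I y : EReal)) ≤ ((0 : ℝ≥0∞) : EReal) :=
    (iInf₂_le x (mem_interior_iff_mem_nhds.2 hC)).trans_eq (by rw [hx])
  have hJI := EReal.neg_le_neg_iff.1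
    (((hI.lower C hCm).trans (hI.middle C hCm)).trans (hJ.upper C hCm))
  exact hc0.not_ge (EReal.coe_ennreal_le_coe_ennreal_iff.1 ((hcJ.trans hJI).trans hI0))

end LocalBounds

section BallVolume

variable {V : ℝ → ℝ} {R α δ : ℝ}

theorem IsOrlicz.volume_orliczBall_le (hV : IsOrlicz V) (hα : α < 0) (n : ℕ) :
    volume (orliczBall V R n) ≤
      ENNReal.ofReal (Real.exp (n * (cgf V volume α - α * R))) := by
  have hsum (x : Fin n → ℝ) (hx : x ∈ orliczBall V R n) : n * (α * R) ≤ ∑ i, α * V (x i) := by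
    rw [← Finset.mul_sum]
    calc n * (α * R) = α * (R * n) := by ring
      _ ≤ α * ∑ i, V (x i) := mul_le_mul_of_nonpos_left hx hα.le
  refine (pi_le_exp_of_le_sum (hV.continuous.const_mul α).measurable
    (hV.integrable_exp_mul hα) hsum).trans_eq ?_
  rw [cgf, mgf, mul_sub]

theorem IsOrlicz.volume_orliczBall_ne_top (hV : IsOrlicz V) (n : ℕ) :
    volume (orliczBall V R n) ≠ ∞ :=
  ((hV.volume_orliczBall_le neg_one_lt_zero n).trans_lt ENNReal.ofReal_lt_top).ne

theorem IsOrlicz.volume_orliczBall_ne_zero (hV : IsOrlicz V) (hR : 0 < R) (n : ℕ+) :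
    volume (orliczBall V R n) ≠ 0 := by
  have hopen : IsOpen {x : Fin n → ℝ | ∑ i, V (x i) < R * n} :=
    isOpen_lt (continuous_finsetSum _ fun i _ => hV.continuous.comp (continuous_apply i))
      continuous_const
  have hzero : ∑ i : Fin n, V ((0 : Fin n → ℝ) i) < R * n := by
    simp only [Pi.zero_apply, hV.zero, Finset.sum_const_zero]
    positivity
  exact ((hopen.measure_pos volume ⟨0, hzero⟩).trans_le
    (measure_mono fun x (hx : ∑ i, V (x i) < R * n) => hx.le)).ne'

theorem IsOrlicz.eventually_le_volume_orliczBall (hV : IsOrlicz V) (hR : 0 < R) (hα : α < 0)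
    (hαR : deriv (cgf V volume) α = R) (hδ : 0 < δ) :
    ∀ᶠ n : ℕ+ in atTop, ENNReal.ofReal (Real.exp (-(n * (δ - (cgf V volume α - α * R))))) ≤
      volume (orliczBall V R n) := by
  have hrate : (rate V R α (hV.gibbsPM hα) : EReal) < δ := by
    rw [hV.rate_gibbsPM hR.le hα hαR, EReal.coe_ennreal_zero]
    exact EReal.coe_pos.2 hδ
  filter_upwards [hV.eventually_le_volume hR hα hrate isOpen_univ (mem_univ _)] with n hn
  exact hn.trans (measure_mono inter_subset_left)

end BallVolume

section UniformSample

variable {V : ℝ → ℝ} {R α c : ℝ} {μ : ProbabilityMeasure ℝ} {U : Set (ProbabilityMeasure ℝ)}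
  {Ω : ℕ+ → Type*} [∀ n, MeasurableSpace (Ω n)] {P : ∀ n, Measure (Ω n)}
  {X : ∀ n : ℕ+, Ω n → (Fin n → ℝ)}

theorem IsOrlicz.measure_empirical_mem (hV : IsOrlicz V) (hR : 0 < R)
    (hX : ∀ n, pdf.IsUniform (X n) (orliczBall V R n) (P n) volume) (n : ℕ+) (hU : IsOpen U) :
    P n {ω | empirical n (X n ω) ∈ U} =
      volume (orliczBall V R n ∩ {x | empirical n x ∈ U}) / volume (orliczBall V R n) :=
  (hX n).measure_preimage (hV.volume_orliczBall_ne_zero hR n) (hV.volume_orliczBall_ne_top n)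
    (hU.preimage (continuous_empirical n)).measurableSet

theorem IsOrlicz.ae_empirical_mem_momentBall (hV : IsOrlicz V) (hR : 0 < R)
    (hX : ∀ n, pdf.IsUniform (X n) (orliczBall V R n) (P n) volume) (n : ℕ+) :
    ∀ᵐ ω ∂P n, empirical n (X n ω) ∈ momentBall V R := by
  have hempty : orliczBall V R n ∩ {x | empirical n x ∈ (momentBall V R)ᶜ} = ∅ :=
    disjoint_iff_inter_eq_empty.1 <| disjoint_left.2 fun x hx hxc =>
      hxc ((hV.empirical_mem_momentBall_iff hR.le n x).2 hx)
  refine (hV.measure_empirical_mem hR hX n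
    (hV.isCompact_momentBall R).isClosed.isOpen_compl).trans ?_
  rw [hempty, measure_empty, ENNReal.zero_div]

theorem IsOrlicz.exists_nhds_measure_empirical_le (hV : IsOrlicz V) (hR : 0 < R) (hα : α < 0)
    (hαR : deriv (cgf V volume) α = R)
    (hX : ∀ n, pdf.IsUniform (X n) (orliczBall V R n) (P n) volume) (hμ : μ ∈ momentBall V R)
    (hc : (c : EReal) < rate V R α μ) :
    ∃ U ∈ 𝓝 μ, ∀ᶠ n : ℕ+ in atTop, P n {ω | empirical n (X n ω) ∈ U} ≤
      ENNReal.ofReal (Real.exp (-(n * c))) := by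
  set κ := cgf V volume α - α * R
  obtain ⟨d, hcd, hd⟩ := EReal.lt_iff_exists_real_btwn.1 hc
  have hdH : ((d - κ : ℝ) : EReal) < negEntropy (μ : Measure ℝ) volume := by
    rw [EReal.coe_sub]
    exact EReal.sub_lt_of_lt_add' (by rwa [add_comm, ← hV.coe_rate hR.le hα hμ])
  obtain ⟨U, hU, hUd⟩ := hV.exists_nhds_volume_le hR.le hμ hdH
  refine ⟨interior U, interior_mem_nhds.2 hU, ?_⟩
  filter_upwards [hV.eventually_le_volume_orliczBall hR hα hαR
    (sub_pos.2 (EReal.coe_lt_coe_iff.1 hcd))] with n hn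
  rw [hV.measure_empirical_mem hR hX n isOpen_interior]
  have hsub : orliczBall V R n ∩ {x | empirical n x ∈ interior U} ⊆
      orliczBall V R n ∩ {x | empirical n x ∈ U} :=
    fun x hx => ⟨hx.1, interior_subset (s := U) hx.2⟩
  calc volume (orliczBall V R n ∩ {x | empirical n x ∈ interior U}) / volume (orliczBall V R n)
      ≤ ENNReal.ofReal (Real.exp (-(n * (d - κ)))) /
          ENNReal.ofReal (Real.exp (-(n * (d - c - κ)))) :=
        ENNReal.div_le_div ((measure_mono hsub).trans (hUd n)) hn
    _ = ENNReal.ofReal (Real.exp (-(n * c))) := by rw [ofReal_exp_div_ofReal_exp]; ring_nf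

theorem IsOrlicz.eventually_le_measure_empirical (hV : IsOrlicz V) (hR : 0 < R) (hα : α < 0)
    (hX : ∀ n, pdf.IsUniform (X n) (orliczBall V R n) (P n) volume)
    (hc : (rate V R α μ : EReal) < c) (hU : IsOpen U) (hμU : μ ∈ U) :
    ∀ᶠ n : ℕ+ in atTop, ENNReal.ofReal (Real.exp (-(n * c))) ≤
      P n {ω | empirical n (X n ω) ∈ U} := by
  filter_upwards [hV.eventually_le_volume hR hα hc hU hμU] with n hn
  rw [hV.measure_empirical_mem hR hX n hU]
  calc ENNReal.ofReal (Real.exp (-(n * c)))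
      = ENNReal.ofReal (Real.exp (-(n * (c - (cgf V volume α - α * R))))) /
          ENNReal.ofReal (Real.exp (n * (cgf V volume α - α * R))) := by
        rw [ofReal_exp_div_ofReal_exp]; ring_nf
    _ ≤ _ := ENNReal.div_le_div hn (hV.volume_orliczBall_le hα n)

theorem IsOrlicz.hasLocalBounds (hV : IsOrlicz V) (hR : 0 < R) (hα : α < 0)
    (hαR : deriv (cgf V volume) α = R)
    (hX : ∀ n, pdf.IsUniform (X n) (orliczBall V R n) (P n) volume) :
    HasLocalBounds P (fun n ω => empirical n (X n ω)) (rate V R α) (momentBall V R) where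
  isCompact := hV.isCompact_momentBall R
  ae_mem := hV.ae_empirical_mem_momentBall hR hX
  mem_of_lt_top _ := mem_momentBall_of_rate_lt_top
  exists_nhds_le _ hμ _ := hV.exists_nhds_measure_empirical_le hR hα hαR hX hμ
  eventually_le _ _ hc _ := hV.eventually_le_measure_empirical hR hα hX hc

end UniformSample

section FiniteMoment

variable {V W : ℝ → ℝ} {R : ℝ} {dw : MetricSpace (ProbabilityMeasure ℝ)}

theorem IsOrlicz.isLittleO_of_tendsto_div (hV : IsOrlicz V) (hW : IsOrlicz W)
    (h : Tendsto (fun x => V x / W x) (Bornology.cobounded ℝ) atTop) : W =o[cocompact ℝ] V := by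
  rw [Metric.cobounded_eq_cocompact] at h
  refine Asymptotics.isLittleO_iff.2 fun ε hε => ?_
  filter_upwards [h.eventually_ge_atTop ε⁻¹] with x hx
  rw [Real.norm_of_nonneg (hV.nonneg x), Real.norm_of_nonneg (hW.nonneg x)]
  obtain h0 | h0 := (hW.nonneg x).eq_or_lt
  · rw [← h0]
    exact mul_nonneg hε.le (hV.nonneg x)
  · rwa [le_div_iff₀ h0, inv_mul_le_iff₀ hε] at hx

theorem IsOrlicz.moment_lt_top_of_isLittleO (hV : IsOrlicz V) (hW : IsOrlicz W)
    (ho : W =o[cocompact ℝ] V) {μ : ProbabilityMeasure ℝ} (hμ : μ ∈ momentBall V R) :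
    moment W μ < ∞ :=
  lt_top_iff_ne_top.2 ((lintegral_ofReal_ne_top_iff_integrable hW.continuous.aestronglyMeasurable
    (ae_of_all _ hW.nonneg)).2
      (integrable_of_isLittleO hV.continuous hV.nonneg hW.continuous ho hμ))

theorem InducesWeakTopology.tendsto_dist (hdw : InducesWeakTopology dw)
    (μ : ProbabilityMeasure ℝ) : Tendsto (fun ν => dw.dist ν μ) (𝓝 μ) (𝓝 0) := by
  have h := @nhds_comap_dist _ dw.toPseudoMetricSpace μ
  rw [hdw] at h
  exact h ▸ tendsto_comap

theorem continuous_val_finiteMoment (hdw : InducesWeakTopology dw) :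
    letI : MetricSpace (FiniteMoment W) := wassersteinMetric dw W
    Continuous fun μ : FiniteMoment W => μ.1 := by
  let : MetricSpace (FiniteMoment W) := wassersteinMetric dw W
  have h : @Continuous _ _ _ dw.toPseudoMetricSpace.toUniformSpace.toTopologicalSpace
      fun μ : FiniteMoment W => μ.1 := by
    let := dw
    refine (LipschitzWith.of_dist_le_mul (K := 1) fun μ ν => ?_).continuous
    rw [NNReal.coe_one, one_mul]
    exact le_add_of_nonneg_right (abs_nonneg _)
  rwa [hdw] at h

theorem IsOrlicz.comap_nhdsWithin_momentBall_le (hV : IsOrlicz V) (hR : 0 ≤ R) (hW : IsOrlicz W)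
    (ho : W =o[cocompact ℝ] V) (hdw : InducesWeakTopology dw) {μ : FiniteMoment W}
    (hμ : μ.1 ∈ momentBall V R) :
    letI : MetricSpace (FiniteMoment W) := wassersteinMetric dw W
    comap (fun ν : FiniteMoment W => ν.1) (𝓝[momentBall V R] μ.1) ≤ 𝓝 μ := by
  let : MetricSpace (FiniteMoment W) := wassersteinMetric dw W
  have hdist : Tendsto (fun ν => dw.dist ν μ.1) (𝓝[momentBall V R] μ.1) (𝓝 0) :=
    (hdw.tendsto_dist μ.1).mono_left nhdsWithin_le_nhds
  have hmoment : Tendsto (fun ν => |(moment W ν).toReal - (moment W μ.1).toReal|)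
      (𝓝[momentBall V R] μ.1) (𝓝 0) := by
    have h := (continuousOn_integral_momentBall hV.continuous hV.nonneg hR hW.continuous ho) μ.1 hμ
    simp_rw [ContinuousWithinAt, hW.integral_eq_toReal_moment] at h
    exact tendsto_iff_dist_tendsto_zero.1 h
  have hsum := (hdist.add hmoment).comp (tendsto_comap (f := fun ν : FiniteMoment W => ν.1))
  rw [add_zero] at hsum
  exact tendsto_id'.1 (tendsto_iff_dist_tendsto_zero.2 hsum)

theorem IsOrlicz.hasLocalBounds_finiteMoment {α : ℝ} {Ω : ℕ+ → Type*}
    [∀ n, MeasurableSpace (Ω n)] {P : ∀ n, Measure (Ω n)} {X : ∀ n : ℕ+, Ω n → (Fin n → ℝ)}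
    (hV : IsOrlicz V) (hR : 0 < R) (hα : α < 0) (hαR : deriv (cgf V volume) α = R)
    (hX : ∀ n, pdf.IsUniform (X n) (orliczBall V R n) (P n) volume) (hW : IsOrlicz W)
    (ho : W =o[cocompact ℝ] V) (hdw : InducesWeakTopology dw) :
    letI : MetricSpace (FiniteMoment W) := wassersteinMetric dw W
    HasLocalBounds P (fun n ω => empiricalFM W n (X n ω)) (fun μ => rate V R α μ.1)
      {μ : FiniteMoment W | μ.1 ∈ momentBall V R} := by
  let : MetricSpace (FiniteMoment W) := wassersteinMetric dw W
  exact HasLocalBounds.of_comp (φ := fun μ : FiniteMoment W => μ.1) (hV.hasLocalBounds hR hα hαR hX)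
    (continuous_val_finiteMoment hdw)
    (fun μ hμ => ⟨⟨μ, hV.moment_lt_top_of_isLittleO hW ho hμ⟩, rfl⟩)
    fun μ hμ => hV.comap_nhdsWithin_momentBall_le hR.le hW ho hdw hμ

end FiniteMoment

end OrliczLDP

theorem theoremA (V : ℝ → ℝ) (hV : IsOrlicz V) (R : ℝ) (hR : 0 < R)
    {Ω : ℕ+ → Type*} [∀ n, MeasurableSpace (Ω n)] (P : ∀ n, Measure (Ω n))
    (hP : ∀ n, IsProbabilityMeasure (P n))
    (X : ∀ n : ℕ+, Ω n → (Fin n → ℝ))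
    (hX : ∀ n, pdf.IsUniform (X n) (orliczBall V R n) (P n) volume) :
    ∃ α : ℝ, α < 0 ∧
      SatisfiesLDP P (fun n ω => empirical n (X n ω)) (rate V R α) ∧
      (∀ β : ℝ, β < 0 →
        SatisfiesLDP P (fun n ω => empirical n (X n ω)) (rate V R β) → β = α) ∧
      StrictlyConvex (rate V R α) ∧
      ∀ W : ℝ → ℝ, IsOrlicz W →
        Tendsto (fun x => V x / W x) (Bornology.cobounded ℝ) atTop →
        ∀ dw : MetricSpace (ProbabilityMeasure ℝ),
          InducesWeakTopology dw →
          letI : MetricSpace (FiniteMoment W) := wassersteinMetric dw W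
          SatisfiesLDP P (fun n ω => empiricalFM W n (X n ω)) (fun μ => rate V R α μ.1) := by
  obtain ⟨α, hα, hαR⟩ := hV.exists_deriv_cgf_eq hR
  have hLDP := (hV.hasLocalBounds hR hα hαR hX).satisfiesLDP
  refine ⟨α, hα, hLDP, fun β hβ hLDPβ => ?_, hV.strictlyConvex_rate hR.le hα,
    fun W hW hVW dw hdw => ?_⟩
  · have hzero := hLDP.eq_zero_of_eq_zero hLDPβ (hV.rate_gibbsPM hR.le hα hαR)
    exact (hV.gibbs_injOn hα hβ (hV.eq_gibbs_of_rate_eq_zero hβ hzero)).symm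
  · let : MetricSpace (FiniteMoment W) := wassersteinMetric dw W
    have ho := hV.isLittleO_of_tendsto_div hW hVW
    exact (hV.hasLocalBounds_finiteMoment hR hα hαR hX hW ho hdw).satisfiesLDP
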